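/- \textbf{Conventions.} Fix a universal prefix-free Turing machine $U$ (programs are binary words, with access to a side-input word). $K(x\mid y)$ is the length of a shortest program that outputs $x$ given side input $y$; $K(x)=K(x\mid\text{empty word})$; $z^*$ is a shortest program that outputs $z$; tuples of words are coded as words by a standard prefix-free code, and $\log$ is to base $2$ with $-\log 0=+\infty$. Let $n\ge 1$, and let $X_1,\dots,X_n$ be random variables with values in $\{0,1\}^*$ forming a causal Bayesian network over a directed acyclic graph $G$, so that $P(x_1,\dots,x_n)=\prod_{j}P(x_j\mid pa_j)$, where $pa_j$ denotes the values of the parents of node $j$. Each mechanism $P_{X_j\mid PA_j}$ is computable and is represented by a word $M_j$, a program for $U$ that computes it to any desired precision. Each marginal distribution $P_{X_i}$ is represented by a word $D_i$, a program for $U$ that computes it and that carries no information beyond the mechanisms up to a constant, $K(D_i\mid (M_1,\dots,M_n)^*)\le c$ (for instance, a program obtained from $M_1,\dots,M_n$ by a fixed marginalization algorithm). For observed values $x_1,\dots,x_n\in\{0,1\}^*$ define the randomness deficiencies \[ \delta(x_i):=-\log P(x_i)-K(x_i\mid D_i^*),\qquad \delta(x_j\mid pa_j):=-\log P(x_j\mid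 pa_j)-K\bigl(x_j\mid (pa_j,M_j)^*\bigr). \] Let $G^1$ be the graph on the $2n$ nodes $x_1,\dots,x_n,M_1,\dots,M_n$ in which the parents of $x_j$ are $pa_j$ and $M_j$, and the $M_j$ have no parents. The algorithmic Markov condition for $G^1$ holds up to $c$ if the joint complexity $K(x_1,\dots,x_n,M_1,\dots,M_n)$ differs by at most $c$ from the sum, over all nodes of $G^1$, of the complexity of the word at the node conditional on a shortest program for the tuple of words at its parents. \textbf{Corollary (Weak outliers do not cause stronger ones).} \label{thm:mon} For every universal prefix-free machine $U$, every $n$ and every constant $c$ there is a constant $C=C(U,n,c)$, which does not depend on the graph, the distributions, their descriptions or the observations, such that for every such network with observations $x_1,\dots,x_n$ the following holds. Assume that the algorithmic Markov condition for $G^1$ holds up to $c$, and that there is a unique root cause $j\in\{1,\dots,n\}$ in the sense that \[ |\delta(x_i\mid pa_i)|\le c\qquad\text{for all } i\neq j . \] Then \[ \delta(x_i)\le\delta(x_j\mid pa_j)+C\qquad\text{for all } i\in\{1,\dots,n\}. \] -/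

import Mathlib

open scoped ENNReal

namespace AIT

noncomputable section

/-! ### Prefix-free machines, Kolmogorov complexity, shortest programs -/

/-- Binary words, the elements of `{0,1}*`. -/
abbrev Word := List Bool

/-- The standard prefix-free code of a tuple of words: every bit is preceded by a `1` and every
component is closed by a `0`. The empty tuple is coded by the empty word. -/
def tuple (l : List Word) : Word :=
  l.flatMap fun w => (w.flatMap fun b => [true, b]) ++ [false]

/-- A prefix-free machine `V`, taking a program and a side input: a partial computable function
such that for each side input `y` the set of programs on which it halts is prefix-free. -/
def IsPrefixMachine (V : Word → Word →. Word) : Prop :=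
  Partrec₂ V ∧ ∀ y p q : Word, (V p y).Dom → (V q y).Dom → p <+: q → p = q

/-- A universal prefix-free machine: it simulates every prefix-free machine `V` on the programs
that start with some word `s` belonging to `V`. -/
def IsUniversal (U : Word → Word →. Word) : Prop :=
  IsPrefixMachine U ∧
    ∀ V : Word → Word →. Word, IsPrefixMachine V → ∃ s : Word, ∀ p y, U (s ++ p) y = V p y

/-- Conditional (prefix) Kolmogorov complexity `K(x ∣ y)`. The unconditional complexity `K(x)` is
`K(x ∣ y)` for the empty word `y`. -/
def K (U : Word → Word →. Word) (x y : Word) : ℕ :=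
  sInf {l : ℕ | ∃ p : Word, x ∈ U p y ∧ p.length = l}

/-- `z*`, a (fixed choice of a) shortest program that outputs `z`. -/
def shortestProgram (U : Word → Word →. Word) (z : Word) : Word :=
  Classical.epsilon fun p : Word => z ∈ U p [] ∧ p.length = K U z []

/-! ### The algorithmic Markov condition -/

/-- The set of parents (direct causes) of a node of a directed graph. -/
def parents {V : Type} [Fintype V] (G : Digraph V) (v : V) : Finset V :=
  open Classical in Finset.univ.filter fun u => G.Adj u v

theorem mem_parents {V : Type} [Fintype V] (G : Digraph V) (u v : V) :
    u ∈ parents G v ↔ G.Adj u v := by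
  classical
  exact Finset.mem_filter.trans (by simp)

/-- A directed graph without directed cycles. -/
def IsAcyclic {V : Type} (G : Digraph V) : Prop :=
  ∀ v, ¬ Relation.TransGen G.Adj v v

/-- The tuple of the words `w v`, `v ∈ s`, listed in increasing order of `v`. -/
def tupleOn {V : Type} [LinearOrder V] (w : V → Word) (s : Finset V) : Word :=
  tuple ((s.sort (· ≤ ·)).map w)

/-- The algorithmic Markov condition for the words `w` at the nodes of `G`, with error term at
most `c`: `K(w₁, …, w_N) = ∑ᵥ K(wᵥ ∣ paᵥ*)` up to `c`. -/
def AlgMarkov (U : Word → Word →. Word) {V : Type} [Fintype V] [LinearOrder V]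
    (G : Digraph V) (w : V → Word) (c : ℕ) : Prop :=
  |(K U (tupleOn w Finset.univ) [] : ℤ)
      - ∑ v, (K U (w v) (shortestProgram U (tupleOn w (parents G v))) : ℤ)| ≤ c

/-- The graph `G¹`: the left copy of a node `j` stands for its observation, the right copy for
its mechanism. The edges between observations are those of `G`, and the mechanism of `j` is a
further parent of the observation at `j`. Mechanisms have no parents. -/
def augment {V : Type} (G : Digraph V) : Digraph (V ⊕ₗ V) where
  Adj a b :=
    match ofLex a, ofLex b with
    | Sum.inl i, Sum.inl j => G.Adj i j
    | Sum.inr i, Sum.inl j => i = j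
    | _, Sum.inr _ => False

/-! ### Causal networks with computable mechanisms -/

/-- The word `d` is a program that, given the word `y`, computes the function `P`: for every word
`a` and every `k` (in unary) it outputs a natural number `m` (in unary, as the length of the
output) with `|m / 2ᵏ - P a| ≤ 2⁻ᵏ`. -/
def Computes (U : Word → Word →. Word) (d y : Word) (P : Word → ℝ≥0∞) : Prop :=
  ∀ (a : Word) (k : ℕ), ∃ r ∈ U d (tuple [y, a, List.replicate k true]),
    |(r.length : ℝ) / 2 ^ k - (P a).toReal| ≤ 1 / 2 ^ k

/-- A causal Bayesian network with nodes `X₁, …, Xₙ` taking values in `{0,1}*` and with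
computable mechanisms: a directed acyclic graph, for each node `j` the conditional distribution
of `X_j` given its parents, and a word describing this mechanism, i.e. a program that computes
it. -/
structure CausalNetwork (U : Word → Word →. Word) (n : ℕ) where
  graph : Digraph (Fin n)
  acyclic : IsAcyclic graph
  mechanism : (j : Fin n) → ({i : Fin n // i ∈ parents graph j} → Word) → PMF Word
  word : Fin n → Word
  word_computes : ∀ (j : Fin n) (x : Fin n → Word),
    Computes U (word j) (tupleOn x (parents graph j)) (mechanism j fun i => x i)

/-- `-log₂ p`, with value `∞` at `p = 0`. -/
def negLog (p : ℝ≥0∞) : EReal :=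
  if p = 0 then ⊤ else ((-Real.logb 2 p.toReal : ℝ) : EReal)

/-- The randomness deficiency `-log₂ p - K(x ∣ z*)` of a word `x` that has probability `p` under
a distribution described by (or together with further data contained in) the word `z`. -/
def deficiency (U : Word → Word →. Word) (p : ℝ≥0∞) (x z : Word) : EReal :=
  negLog p - ((K U x (shortestProgram U z) : ℝ) : EReal)

namespace CausalNetwork

variable {U : Word → Word →. Word} {n : ℕ} (N : CausalNetwork U n)

/-- `P(x_j ∣ pa_j)`. -/
def condProb (x : Fin n → Word) (j : Fin n) : ℝ≥0∞ :=
  N.mechanism j (fun i => x i) (x j)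

/-- The joint distribution, `P(x₁, …, xₙ) = ∏ⱼ P(x_j ∣ pa_j)`. -/
def joint (x : Fin n → Word) : ℝ≥0∞ :=
  ∏ j, N.condProb x j

/-- The marginal distribution of `X_i`. -/
def marginal (i : Fin n) (a : Word) : ℝ≥0∞ :=
  ∑' x : {x : Fin n → Word // x i = a}, N.joint x

/-- The words at the nodes of `G¹`: the observations and the descriptions of the mechanisms. -/
def nodeWords (x : Fin n → Word) (v : Fin n ⊕ₗ Fin n) : Word :=
  Sum.elim x N.word (ofLex v)

/-- The conditional randomness deficiency
`δ(x_j ∣ pa_j) = -log₂ P(x_j ∣ pa_j) - K(x_j ∣ (pa_j, P_{X_j ∣ PA_j})*)`. -/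
def condDeficiency (x : Fin n → Word) (j : Fin n) : EReal :=
  deficiency U (N.condProb x j) (x j)
    (tuple (((parents N.graph j).sort (· ≤ ·)).map x ++ [N.word j]))

/-- The word `d` describes the marginal distribution of `X_i`: it is a program that computes it,
and up to `c` bits it is determined by (a shortest program for) the descriptions of the
mechanisms. -/
def DescribesMarginal (c : ℕ) (i : Fin n) (d : Word) : Prop :=
  Computes U d [] (N.marginal i) ∧ K U d (shortestProgram U (tupleOn N.word Finset.univ)) ≤ c

/-- The marginal randomness deficiency `δ(x_i) = -log₂ P(x_i) - K(x_i ∣ (P_{X_i})*)`, where the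
word `d` describes `P_{X_i}`. -/
def margDeficiency (i : Fin n) (d a : Word) : EReal :=
  deficiency U (N.marginal i a) a d

end CausalNetwork

end

end AIT

/-!
Write `M` for the tuple of all mechanism descriptions, `D` for the description of the marginal
distribution of `X_i`, `z*` for a shortest program of `z`, and ignore additive constants. It
suffices to bound the marginal deficiency `δ(x_i)` by the sum of all conditional deficiencies,
since all terms of this sum but the one at the root cause are at most `c`; that is `∑ⱼ K(x_j ∣
(pa_j, M_j)*) ≤ K(x_i ∣ D*) - log (P(x) / P(x_i))`, which is `IsUniversal.exists_sum_K_le`. The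
algorithmic Markov condition and `K(M) ≤ ∑ⱼ K(M_j)` bound the left side by `K(x, M) - K(M)`. For
an upper bound of `K(x, M)`, describe `D` by `D*`, then `M` and `x_i` relative to `D*`, and
finally `x` relative to `(M, D, x_i)` by a Shannon–Fano code for the distribution of `X`
conditional on `X_i = x_i`. This takes `K(D) + K(M ∣ D*) + K(x_i ∣ D*) - log (P(x) / P(x_i))`
bits, and by the chain rule `K(D) + K(M ∣ D*) = K(M, D) = K(M) + K(D ∣ M*) = K(M)`, because `D`
carries no information beyond the mechanisms.

Two ingredients go beyond concatenating programs. The inequality `K(b) + K(a ∣ b*) ≤ K(a, b)`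
(`IsUniversal.exists_le_K_pair`) and the Shannon–Fano code (`IsUniversal.exists_K_tupleOn_le`)
need machines with prescribed codelengths. Both come from one coding theorem,
`IsUniversal.exists_K_le_of_lt`: semidecidable lower bounds `2⁻ᵏ < m w` for a semimeasure `m`
yield `K(w) ≤ k`. It rests on the Kraft–Chaitin construction `IsUniversal.exists_K_le_of_kraft`,
which serves the requests `(w, l)` in the order of their enumeration by consecutive intervals of
length `2⁻ˡ`. Computability is handled by a small calculus of semidecidable predicates
(`SemiDec`): machines are specified by semidecidable relations between program, side input and
output.

A mechanism that gives probability `0` to the observation has deficiency `∞`. By assumption this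
can only happen at the root cause, where it makes the bound trivial.
-/

namespace AIT

/-! ### Primitive recursive functions and semidecidable predicates -/

section Primrec

variable {α β γ σ : Type*} [Primcodable α] [Primcodable β] [Primcodable γ] [Primcodable σ]

attribute [fun_prop] Primrec

@[fun_prop] theorem primrec_id : Primrec fun a : α => a := Primrec.id

attribute [fun_prop] Primrec.const Primrec.comp Primrec.pair

@[fun_prop] theorem _root_.Primrec.fst' {f : α → β × γ} (hf : Primrec f) :
    Primrec fun a => (f a).1 :=
  Primrec.fst.comp hf

@[fun_prop] theorem _root_.Primrec.snd' {f : α → β × γ} (hf : Primrec f) :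
    Primrec fun a => (f a).2 :=
  Primrec.snd.comp hf

@[fun_prop] theorem _root_.Primrec.add' {f g : α → ℕ} (hf : Primrec f) (hg : Primrec g) :
    Primrec fun a => f a + g a := Primrec.nat_add.comp hf hg

@[fun_prop] theorem _root_.Primrec.sub' {f g : α → ℕ} (hf : Primrec f) (hg : Primrec g) :
    Primrec fun a => f a - g a := Primrec.nat_sub.comp hf hg

@[fun_prop] theorem _root_.Primrec.mul' {f g : α → ℕ} (hf : Primrec f) (hg : Primrec g) :
    Primrec fun a => f a * g a := Primrec.nat_mul.comp hf hg

@[fun_prop] theorem _root_.Primrec.pow' {f g : α → ℕ} (hf : Primrec f) (hg : Primrec g) :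
    Primrec fun a => f a ^ g a := (Primrec₂.unpaired'.1 Nat.Primrec.pow).comp hf hg

@[fun_prop] theorem _root_.Primrec.append' {f g : α → List β} (hf : Primrec f) (hg : Primrec g) :
    Primrec fun a => f a ++ g a := Primrec.list_append.comp hf hg

@[fun_prop] theorem _root_.Primrec.cons' {f : α → β} {g : α → List β} (hf : Primrec f)
    (hg : Primrec g) : Primrec fun a => f a :: g a := Primrec.list_cons.comp hf hg

@[fun_prop] theorem _root_.Primrec.length' {f : α → List β} (hf : Primrec f) :
    Primrec fun a => (f a).length := Primrec.list_length.comp hf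

@[fun_prop] theorem _root_.Primrec.some' {f : α → β} (hf : Primrec f) :
    Primrec fun a => some (f a) := Primrec.option_some.comp hf

theorem _root_.Primrec.fin_app' {n : ℕ} {f : α → Fin n → β} (hf : Primrec f) (j : Fin n) :
    Primrec fun a => f a j := Primrec.fin_app.comp hf (Primrec.const j)

theorem _root_.Primrec.fin_prod {n : ℕ} {f : Fin n → α → ℕ} (hf : ∀ j, Primrec (f j)) :
    Primrec fun a => ∏ j, f j a := by
  suffices ∀ s : Finset (Fin n), Primrec fun a => ∏ j ∈ s, f j a from this _
  classical
  intro s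
  induction s using Finset.induction_on with
  | empty => simpa using Primrec.const 1
  | insert j s hj ih =>
    simp only [Finset.prod_insert hj]
    have := hf j
    fun_prop

theorem _root_.Primrec.map_const_list {ι : Type*} {f : ι → α → β} (l : List ι)
    (hf : ∀ i, Primrec (f i)) : Primrec fun a => l.map fun i => f i a := by
  induction l with
  | nil => simpa using Primrec.const []
  | cons i l ih =>
    simp only [List.map_cons]
    have := hf i
    fun_prop

@[fun_prop] theorem primrec_tuple {f : α → List Word} (hf : Primrec f) :
    Primrec fun a => tuple (f a) := by
  unfold tuple
  refine Primrec.list_flatMap hf (Primrec.append' (Primrec.list_flatMap Primrec.snd ?_) ?_)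
  · exact Primrec.cons' (Primrec.const _) (Primrec.cons' Primrec.snd (Primrec.const _))
  · exact Primrec.const _

theorem _root_.PrimrecPred.eq' {f g : α → β} (hf : Primrec f) (hg : Primrec g) :
    PrimrecPred fun a => f a = g a := by
  classical
  exact Primrec.eq.comp hf hg

theorem _root_.PrimrecPred.le' {f g : α → ℕ} (hf : Primrec f) (hg : Primrec g) :
    PrimrecPred fun a => f a ≤ g a := Primrec.nat_le.comp hf hg

theorem _root_.PrimrecPred.lt' {f g : α → ℕ} (hf : Primrec f) (hg : Primrec g) :
    PrimrecPred fun a => f a < g a := Primrec.nat_lt.comp hf hg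

/-- Semidecidable (recursively enumerable) predicates, in Kleene's normal form: the projection of
a primitive recursive predicate along a natural number. -/
def SemiDec (p : α → Prop) : Prop :=
  ∃ Q : α × ℕ → Prop, PrimrecPred Q ∧ ∀ a, p a ↔ ∃ s, Q (a, s)

namespace SemiDec

theorem of_primrec {p : α → Prop} (h : PrimrecPred p) : SemiDec p :=
  ⟨fun q => p q.1, h.comp Primrec.fst, fun a => by simp⟩

theorem of_eq {p q : α → Prop} (h : SemiDec p) (H : ∀ a, p a ↔ q a) : SemiDec q := by
  rwa [show q = p from funext fun a => propext (H a).symm]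

theorem comp {p : β → Prop} (h : SemiDec p) {f : α → β} (hf : Primrec f) :
    SemiDec fun a => p (f a) := by
  obtain ⟨Q, hQ, h⟩ := h
  exact ⟨fun q => Q (f q.1, q.2), hQ.comp (f := fun q : α × ℕ => (f q.1, q.2)) (by fun_prop),
    fun a => h _⟩

theorem eq {f g : α → β} (hf : Primrec f) (hg : Primrec g) : SemiDec fun a => f a = g a :=
  of_primrec (PrimrecPred.eq' hf hg)

theorem le {f g : α → ℕ} (hf : Primrec f) (hg : Primrec g) : SemiDec fun a => f a ≤ g a :=
  of_primrec (PrimrecPred.le' hf hg)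

theorem lt {f g : α → ℕ} (hf : Primrec f) (hg : Primrec g) : SemiDec fun a => f a < g a :=
  of_primrec (PrimrecPred.lt' hf hg)

theorem exists_snd {p : α → β → Prop} (h : SemiDec fun q : α × β => p q.1 q.2) :
    SemiDec fun a => ∃ b, p a b := by
  obtain ⟨Q, hQ, h⟩ := h
  refine ⟨fun q => ∃ b ∈ (Encodable.decode (α := β) q.2.unpair.1).toList,
    Q ((q.1, b), q.2.unpair.2), ?_, fun a => ?_⟩
  · have h1 : PrimrecRel fun (b : β) (q : α × ℕ) => Q ((q.1, b), q.2.unpair.2) := by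
      refine hQ.comp (f := fun r : β × α × ℕ => ((r.2.1, r.1), r.2.2.unpair.2)) ?_
      exact Primrec.pair (by fun_prop)
        (Primrec.snd.comp (Primrec.unpair.comp (Primrec.snd.comp Primrec.snd)))
    refine (h1.exists_mem_list).comp (f := fun q : α × ℕ =>
      (Encodable.decode (α := β) q.2.unpair.1).toList) (g := fun q => q) ?_ Primrec.id
    exact Primrec.optionToList.comp (Primrec.decode.comp
      (Primrec.fst.comp (Primrec.unpair.comp Primrec.snd)))
  · constructor
    · rintro ⟨b, hb⟩
      obtain ⟨s, hs⟩ := (h (a, b)).1 hb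
      exact ⟨Nat.pair (Encodable.encode b) s, b, by simp, by simpa using hs⟩
    · rintro ⟨s, b, -, hs⟩
      exact ⟨b, (h (a, b)).2 ⟨_, hs⟩⟩

theorem and {p q : α → Prop} (hp : SemiDec p) (hq : SemiDec q) : SemiDec fun a => p a ∧ q a := by
  obtain ⟨P, hP, hp⟩ := hp
  obtain ⟨Q, hQ, hq⟩ := hq
  have : SemiDec fun a => ∃ st : ℕ × ℕ, P (a, st.1) ∧ Q (a, st.2) := by
    refine exists_snd (of_primrec (PrimrecPred.and ?_ ?_))
    · exact hP.comp (f := fun r : α × ℕ × ℕ => (r.1, r.2.1)) (by fun_prop)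
    · exact hQ.comp (f := fun r : α × ℕ × ℕ => (r.1, r.2.2)) (by fun_prop)
  exact this.of_eq fun a => by simp [hp, hq]

theorem forall_fin {n : ℕ} {p : Fin n → α → Prop} (h : ∀ j, SemiDec (p j)) :
    SemiDec fun a => ∀ j, p j a := by
  suffices ∀ s : Finset (Fin n), SemiDec fun a => ∀ j ∈ s, p j a from
    (this Finset.univ).of_eq (by simp)
  classical
  intro s
  induction s using Finset.induction_on with
  | empty => exact (eq (Primrec.const 0) (Primrec.const 0)).of_eq (by simp)
  | insert j s hj ih => exact ((h j).and ih).of_eq (by simp)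

/-- The graph of a partial computable function is semidecidable. -/
theorem of_partrec {f : α →. β} (hf : Partrec f) : SemiDec fun q : α × β => q.2 ∈ f q.1 := by
  obtain ⟨c, hc⟩ := Nat.Partrec.Code.exists_code.1 hf
  refine ⟨fun q => Nat.Partrec.Code.evaln q.2 c (Encodable.encode q.1.1)
    = some (Encodable.encode q.1.2), PrimrecPred.eq' ?_ ?_, ?_⟩
  · exact Nat.Partrec.Code.primrec_evaln.comp
      (Primrec.pair (Primrec.pair Primrec.snd (Primrec.const c))
        (Primrec.encode.comp (Primrec.fst.comp Primrec.fst)))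
  · exact Primrec.option_some.comp (Primrec.encode.comp (Primrec.snd.comp Primrec.fst))
  · rintro ⟨a, b⟩
    simp only [← Option.mem_def]
    rw [← Nat.Partrec.Code.evaln_complete, hc]
    simp

/-- A semidecidable relation that is the graph of a partial function defines a partial computable
function. -/
theorem exists_partrec {R : α → β → Prop} (h : SemiDec fun q : α × β => R q.1 q.2)
    (hR : ∀ a b b', R a b → R a b' → b = b') :
    ∃ f : α →. β, Partrec f ∧ ∀ a b, b ∈ f a ↔ R a b := by
  classical
  obtain ⟨Q, hQ, h⟩ := h
  obtain ⟨_, hQ⟩ := hQ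
  let g : α → ℕ → Option β := fun a s =>
    (Encodable.decode (α := β) s.unpair.1).bind fun b =>
      if Q ((a, b), s.unpair.2) then some b else none
  have hg : Primrec₂ g := by
    refine Primrec.option_bind (Primrec.decode.comp
      (Primrec.fst.comp (Primrec.unpair.comp Primrec.snd))) ?_
    refine Primrec.ite ?_ (Primrec.option_some.comp Primrec.snd) (Primrec.const none)
    have hQ' : PrimrecPred Q := ⟨_, hQ⟩
    refine hQ'.comp (f := fun r : (α × ℕ) × β => ((r.1.1, r.2), r.1.2.unpair.2)) ?_
    exact Primrec.pair (by fun_prop)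
      (Primrec.snd.comp (Primrec.unpair.comp (Primrec.snd.comp Primrec.fst)))
  have hgR : ∀ a s b, g a s = some b → R a b := by
    intro a s b hs
    simp only [g, Option.bind_eq_some_iff] at hs
    obtain ⟨b', -, hs⟩ := hs
    split_ifs at hs with hq
    obtain rfl := Option.some.inj hs
    exact (h (a, b')).2 ⟨_, hq⟩
  refine ⟨fun a => Nat.rfindOpt (g a), Partrec.rfindOpt hg.to_comp, fun a b => ⟨fun hb => ?_,
    fun hb => ?_⟩⟩
  · obtain ⟨s, hs⟩ := Nat.rfindOpt_spec hb
    exact hgR a s b hs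
  · obtain ⟨s, hs⟩ := (h (a, b)).1 hb
    have hdom : (Nat.rfindOpt (g a)).Dom := by
      refine Nat.rfindOpt_dom.2 ⟨Nat.pair (Encodable.encode b) s, b, ?_⟩
      simpa [g] using hs
    obtain ⟨b', hb'⟩ := Part.dom_iff_mem.1 hdom
    obtain ⟨s', hs'⟩ := Nat.rfindOpt_spec hb'
    rwa [hR a b b' hb (hgR a s' b' hs')]

end SemiDec

end Primrec

/-! ### Tuples and the parsing of programs -/

theorem tuple_cons (w : Word) (l : List Word) : tuple (w :: l) = tuple [w] ++ tuple l := by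
  simp [tuple]

theorem tuple_append (l m : List Word) : tuple (l ++ m) = tuple l ++ tuple m := by
  simp [tuple]

theorem tuple_nil : tuple [] = [] := rfl

theorem tuple_singleton_append_inj {v w r s : Word} (h : tuple [v] ++ r = tuple [w] ++ s) :
    v = w ∧ r = s := by
  induction v generalizing w with
  | nil => cases w <;> simp_all [tuple]
  | cons b v ih =>
    cases w with
    | nil => simp [tuple] at h
    | cons b' w =>
      obtain ⟨h1, h2⟩ : b = b' ∧ tuple [v] ++ r = tuple [w] ++ s := by
        simpa [tuple] using h
      obtain ⟨rfl, rfl⟩ := ih h2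
      simp [h1]

theorem tuple_injective : Function.Injective tuple := by
  intro l m h
  induction l generalizing m with
  | nil =>
    cases m with
    | nil => rfl
    | cons w m => simp [tuple] at h
  | cons v l ih =>
    cases m with
    | nil => simp [tuple] at h
    | cons w m =>
      rw [tuple_cons v, tuple_cons w] at h
      obtain ⟨rfl, hlm⟩ := tuple_singleton_append_inj h
      rw [ih hlm]

variable {U : Word → Word →. Word}

/-- Programs of a prefix-free machine can be read off from the beginning of a word, so that
concatenations of programs form a prefix-free code again. -/
theorem IsPrefixMachine.parse {V : Word → Word →. Word} (hV : IsPrefixMachine V)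
    {y p q r s v w : Word} (hp : v ∈ V p y) (hq : w ∈ V q y) (h : p ++ r <+: q ++ s) :
    p = q ∧ v = w ∧ r <+: s := by
  have hpq : p = q := by
    have h1 : p <+: q ++ s := (List.prefix_append p r).trans h
    rcases List.prefix_or_prefix_of_prefix h1 (List.prefix_append q s) with h2 | h2
    · exact hV.2 y p q (Part.dom_iff_mem.2 ⟨_, hp⟩) (Part.dom_iff_mem.2 ⟨_, hq⟩) h2
    · exact (hV.2 y q p (Part.dom_iff_mem.2 ⟨_, hq⟩) (Part.dom_iff_mem.2 ⟨_, hp⟩) h2).symm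
  subst hpq
  exact ⟨rfl, Part.mem_unique hp hq, (List.prefix_append_right_inj p).1 h⟩

theorem SemiDec.machine {V : Word → Word →. Word} (hV : IsPrefixMachine V)
    {α : Type*} [Primcodable α] {p y w : α → Word}
    (hp : Primrec p) (hy : Primrec y) (hw : Primrec w) : SemiDec fun a => w a ∈ V (p a) (y a) :=
  (SemiDec.of_partrec (f := fun q : Word × Word => V q.1 q.2) hV.1).comp
    (f := fun a => ((p a, y a), w a)) (by fun_prop)

/-! ### Upper bounds for the complexity -/

theorem K_le {p y w : Word} (h : w ∈ U p y) : K U w y ≤ p.length :=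
  Nat.sInf_le ⟨p, h, rfl⟩

/-- Every decoding procedure for prefix-free programs bounds the complexity: `R p y w` says that
the program `p` describes `w` given `y`. -/
theorem IsUniversal.exists_K_le (hU : IsUniversal U) {R : Word → Word → Word → Prop}
    (hR : SemiDec fun q : (Word × Word) × Word => R q.1.1 q.1.2 q.2)
    (hpf : ∀ y p q v w, R p y v → R q y w → p <+: q → p = q ∧ v = w) :
    ∃ c : ℕ, ∀ p y w, R p y w → ∃ q, w ∈ U q y ∧ q.length = p.length + c := by
  obtain ⟨f, hf, hfR⟩ := SemiDec.exists_partrec (R := fun a : Word × Word => R a.1 a.2) hR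
    fun a v w hv hw => (hpf a.2 a.1 a.1 v w hv hw (List.prefix_refl _)).2
  obtain ⟨s, hs⟩ := hU.2 (fun p y => f (p, y)) ⟨hf, fun y p q hp hq h => by
    obtain ⟨v, hv⟩ := Part.dom_iff_mem.1 hp
    obtain ⟨w, hw⟩ := Part.dom_iff_mem.1 hq
    exact (hpf y p q v w ((hfR _ _).1 hv) ((hfR _ _).1 hw) h).1⟩
  refine ⟨s.length, fun p y w h => ⟨s ++ p, ?_, ?_⟩⟩
  · rw [hs]
    exact (hfR (p, y) w).2 h
  · rw [List.length_append, add_comm]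

/-- Every word has a program: `p = tuple [w]` is a prefix-free encoding of `w`. -/
theorem IsUniversal.exists_program (hU : IsUniversal U) (w y : Word) : ∃ p, w ∈ U p y := by
  obtain ⟨c, hc⟩ := hU.exists_K_le (R := fun p _ w => p = tuple [w])
    (SemiDec.eq (by fun_prop) (by fun_prop)) (by
      rintro y _ _ v w rfl rfl ⟨t, ht⟩
      obtain ⟨rfl, -⟩ := tuple_singleton_append_inj (r := t) (s := []) (by simpa using ht)
      exact ⟨rfl, rfl⟩)
  obtain ⟨q, hq, -⟩ := hc _ y w rfl
  exact ⟨q, hq⟩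

theorem IsUniversal.exists_K_eq (hU : IsUniversal U) (w y : Word) :
    ∃ p, w ∈ U p y ∧ p.length = K U w y := by
  obtain ⟨p, hp⟩ := hU.exists_program w y
  exact Nat.sInf_mem (s := {l : ℕ | ∃ p : Word, w ∈ U p y ∧ p.length = l}) ⟨_, p, hp, rfl⟩

theorem IsUniversal.shortestProgram_spec (hU : IsUniversal U) (z : Word) :
    z ∈ U (shortestProgram U z) [] ∧ (shortestProgram U z).length = K U z [] :=
  Classical.epsilon_spec (hU.exists_K_eq z [])

/-- The easy half of the chain rule for prefix complexity. -/
theorem IsUniversal.exists_K_pair_le (hU : IsUniversal U) :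
    ∃ c : ℕ, ∀ a b : Word,
      K U (tuple [b, a]) [] ≤ K U b [] + K U a (shortestProgram U b) + c := by
  have hM := hU.1
  obtain ⟨c, hc⟩ := hU.exists_K_le (R := fun P y w => y = [] ∧ ∃ t : (Word × Word) × Word × Word,
      P = t.1.1 ++ t.1.2 ∧ t.2.2 ∈ U t.1.1 [] ∧ t.2.1 ∈ U t.1.2 t.1.1 ∧ w = tuple [t.2.2, t.2.1])
    (by
      refine SemiDec.and (SemiDec.eq (by fun_prop) (by fun_prop)) (SemiDec.exists_snd ?_)
      refine .and (.eq ?_ ?_) (.and (.machine hM ?_ ?_ ?_) (.and (.machine hM ?_ ?_ ?_)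
        (.eq ?_ ?_))) <;> fun_prop)
    (by
      rintro y _ _ v w ⟨-, ⟨⟨p, q⟩, a, b⟩, rfl, hb, ha, rfl⟩
        ⟨-, ⟨⟨p', q'⟩, a', b'⟩, rfl, hb', ha', rfl⟩ h
      obtain ⟨rfl, h1, h⟩ := hM.parse hb hb' h
      obtain ⟨rfl, h2, h⟩ := hM.parse (r := []) (s := []) ha ha' (by simpa using h)
      simp_all)
  refine ⟨c, fun a b => ?_⟩
  obtain ⟨hp, hpl⟩ := hU.shortestProgram_spec b
  obtain ⟨q, hq, hql⟩ := hU.exists_K_eq a (shortestProgram U b)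
  obtain ⟨r, hr, hrl⟩ := hc (shortestProgram U b ++ q) [] (tuple [b, a])
    ⟨rfl, ⟨⟨_, _⟩, _, _⟩, rfl, hp, hq, rfl⟩
  have := K_le hr
  simp only [List.length_append] at hrl
  omega

/-- The complexity of a tuple is at most the sum of the complexities of its entries, each relative
to a fixed word `e`. -/
theorem IsUniversal.exists_K_tuple_le (hU : IsUniversal U) (e : Word) :
    ∃ c : ℕ, ∀ l : List Word,
      K U (tuple l) [] ≤ (l.map fun w => K U w e).sum + c * (l.length + 1) := by
  have hM := hU.1
  obtain ⟨c, hc⟩ := hU.exists_K_le (R := fun P y w => y = [] ∧ ∃ t : (Word × Word) × Word × Word,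
      P = t.1.1 ++ t.1.2 ∧ t.2.1 ∈ U t.1.1 e ∧ t.2.2 ∈ U t.1.2 [] ∧
        w = tuple [t.2.1] ++ t.2.2)
    (by
      refine SemiDec.and (SemiDec.eq (by fun_prop) (by fun_prop)) (SemiDec.exists_snd ?_)
      refine .and (.eq ?_ ?_) (.and (.machine hM ?_ ?_ ?_) (.and (.machine hM ?_ ?_ ?_)
        (.eq ?_ ?_))) <;> fun_prop)
    (by
      rintro y _ _ v w ⟨-, ⟨⟨p, q⟩, a, b⟩, rfl, hb, ha, rfl⟩
        ⟨-, ⟨⟨p', q'⟩, a', b'⟩, rfl, hb', ha', rfl⟩ h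
      obtain ⟨rfl, h1, h⟩ := hM.parse hb hb' h
      obtain ⟨rfl, h2, h⟩ := hM.parse (r := []) (s := []) ha ha' (by simpa using h)
      simp_all)
  refine ⟨max c (K U [] []), fun l => ?_⟩
  induction l with
  | nil => simp [tuple_nil]
  | cons w l ih =>
    obtain ⟨p, hp, hpl⟩ := hU.exists_K_eq w e
    obtain ⟨q, hq, hql⟩ := hU.exists_K_eq (tuple l) []
    obtain ⟨r, hr, hrl⟩ := hc (p ++ q) [] (tuple (w :: l))
      ⟨rfl, ⟨⟨_, _⟩, _, _⟩, rfl, hp, hq, tuple_cons w l⟩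
    have := K_le hr
    simp only [List.length_append] at hrl
    simp only [List.map_cons, List.sum_cons, List.length_cons]
    have h1 : c ≤ max c (K U [] []) := le_max_left _ _
    rw [mul_add_one]
    omega

/-- Description of `X` and `M` in four steps: a shortest program of `D`, then `M` and `a` relative
to that program, and finally `X` relative to all of these. -/
theorem IsUniversal.exists_K_append_le (hU : IsUniversal U) :
    ∃ c : ℕ, ∀ X M D a : Word, K U (X ++ M) [] ≤ K U D [] + K U M (shortestProgram U D)
      + K U a (shortestProgram U D) + K U X (tuple [M, D, a]) + c := by
  have hM := hU.1
  obtain ⟨c, hc⟩ := hU.exists_K_le (R := fun P y w => y = [] ∧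
      ∃ t : ((Word × Word) × Word × Word) × ((Word × Word) × Word × Word),
        P = t.1.1.1 ++ (t.1.1.2 ++ (t.1.2.1 ++ t.1.2.2)) ∧
        t.2.1.1 ∈ U t.1.1.1 [] ∧ t.2.1.2 ∈ U t.1.1.2 t.1.1.1 ∧ t.2.2.1 ∈ U t.1.2.1 t.1.1.1 ∧
        t.2.2.2 ∈ U t.1.2.2 (tuple [t.2.1.2, t.2.1.1, t.2.2.1]) ∧ w = t.2.2.2 ++ t.2.1.2)
    (by
      refine SemiDec.and (SemiDec.eq (by fun_prop) (by fun_prop)) (SemiDec.exists_snd ?_)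
      refine .and (.eq ?_ ?_) (.and (.machine hM ?_ ?_ ?_) (.and (.machine hM ?_ ?_ ?_)
        (.and (.machine hM ?_ ?_ ?_) (.and (.machine hM ?_ ?_ ?_) (.eq ?_ ?_))))) <;> fun_prop)
    (by
      rintro y _ _ v w ⟨-, ⟨⟨⟨p₁, p₂⟩, p₃, p₄⟩, ⟨D, M⟩, a, X⟩, rfl, h₁, h₂, h₃, h₄, rfl⟩
        ⟨-, ⟨⟨⟨p₁', p₂'⟩, p₃', p₄'⟩, ⟨D', M'⟩, a', X'⟩, rfl, h₁', h₂', h₃', h₄', rfl⟩ h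
      obtain ⟨rfl, rfl, h⟩ := hM.parse h₁ h₁' h
      obtain ⟨rfl, rfl, h⟩ := hM.parse h₂ h₂' h
      obtain ⟨rfl, rfl, h⟩ := hM.parse h₃ h₃' h
      obtain ⟨rfl, h5, h⟩ := hM.parse (r := []) (s := []) h₄ h₄' (by simpa using h)
      simp_all)
  refine ⟨c, fun X M D a => ?_⟩
  obtain ⟨h₁, hl₁⟩ := hU.shortestProgram_spec D
  obtain ⟨q₂, h₂, hl₂⟩ := hU.exists_K_eq M (shortestProgram U D)
  obtain ⟨q₃, h₃, hl₃⟩ := hU.exists_K_eq a (shortestProgram U D)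
  obtain ⟨q₄, h₄, hl₄⟩ := hU.exists_K_eq X (tuple [M, D, a])
  obtain ⟨r, hr, hrl⟩ := hc (shortestProgram U D ++ (q₂ ++ (q₃ ++ q₄))) [] (X ++ M)
    ⟨rfl, ⟨⟨⟨_, _⟩, _, _⟩, ⟨_, _⟩, _, _⟩, rfl, h₁, h₂, h₃, h₄, rfl⟩
  have := K_le hr
  simp only [List.length_append] at hrl
  omega

/-! ### Enumeration without repetition -/

section Enumeration

variable {α β : Type*}

open scoped NNReal

/-- A semidecidable set of pairs `(b, l)`, depending on a parameter `a`, can be enumerated without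
repetition, and so that `l` does not exceed the time at which `(b, l)` shows up. -/
theorem SemiDec.exists_enumeration [Primcodable α] [Primcodable β] {R : α → β → ℕ → Prop}
    (hR : SemiDec fun q : α × β × ℕ => R q.1 q.2.1 q.2.2) :
    ∃ g : α → ℕ → Option (β × ℕ), (Primrec fun q : α × ℕ => g q.1 q.2) ∧
      (∀ a t b l, g a t = some (b, l) → R a b l ∧ l ≤ t) ∧
      (∀ a b l, R a b l → ∃ t, g a t = some (b, l)) ∧
      ∀ a s t q, g a s = some q → g a t = some q → s = t := by
  classical
  obtain ⟨Q, hQ, h⟩ := hR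
  let C : α → ℕ → β × ℕ → Prop := fun a t q => Encodable.encode q = t.unpair.1 ∧
    Q ((a, q), t.unpair.2) ∧ ∀ s < t.unpair.2, ¬ Q ((a, q), s)
  let g : α → ℕ → Option (β × ℕ) := fun a t =>
    (Encodable.decode (α := β × ℕ) t.unpair.1).bind fun q => if C a t q then some q else none
  have hg : ∀ a t q, g a t = some q ↔ C a t q := by
    intro a t q
    simp only [g, Option.bind_eq_some_iff]
    constructor
    · rintro ⟨q', -, h'⟩
      split_ifs at h' with hc
      obtain rfl := Option.some.inj h'
      exact hc
    · intro hc
      refine ⟨q, ?_, by simp [hc]⟩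
      rw [← hc.1, Encodable.encodek]
  refine ⟨g, ?_, fun a t b l hs => ?_, fun a b l hs => ?_, fun a s t q hs ht => ?_⟩
  · have hu1 : Primrec fun r : (α × ℕ) × β × ℕ => r.1.2.unpair.1 :=
      Primrec.fst.comp (Primrec.unpair.comp (by fun_prop))
    have hu2 : Primrec fun r : (α × ℕ) × β × ℕ => r.1.2.unpair.2 :=
      Primrec.snd.comp (Primrec.unpair.comp (by fun_prop))
    refine Primrec.option_bind (Primrec.decode.comp
      (Primrec.fst.comp (Primrec.unpair.comp Primrec.snd))) ?_
    refine Primrec.ite (.and (PrimrecPred.eq' (Primrec.encode.comp Primrec.snd) hu1)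
      (.and ?_ ?_)) (Primrec.option_some.comp Primrec.snd) (Primrec.const none)
    · exact hQ.comp (f := fun r : (α × ℕ) × β × ℕ => ((r.1.1, r.2), r.1.2.unpair.2))
        (by fun_prop)
    · have h1 : PrimrecRel fun (s : ℕ) (r : (α × ℕ) × β × ℕ) => ¬ Q ((r.1.1, r.2), s) :=
        (hQ.comp (f := fun r : ℕ × (α × ℕ) × β × ℕ => ((r.2.1.1, r.2.2), r.1))
          (by fun_prop)).not
      exact (h1.forall_mem_list.comp (Primrec.list_range.comp hu2) primrec_id).of_eq (by simp)
  · obtain ⟨h1, h2, -⟩ := (hg a t (b, l)).1 hs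
    refine ⟨(h (a, b, l)).2 ⟨_, h2⟩, ?_⟩
    rw [Encodable.encode_prod_val] at h1
    exact ((Nat.right_le_pair _ _).trans h1.le).trans (Nat.unpair_left_le t)
  · have hex : ∃ s, Q ((a, b, l), s) := (h (a, b, l)).1 hs
    refine ⟨Nat.pair (Encodable.encode (b, l)) (Nat.find hex), (hg _ _ _).2 ⟨by simp, ?_, ?_⟩⟩
    · simpa using Nat.find_spec hex
    · intro s hlt
      exact Nat.find_min hex (by simpa using hlt)
  · obtain ⟨h1, h2, h3⟩ := (hg _ _ _).1 hs
    obtain ⟨h1', h2', h3'⟩ := (hg _ _ _).1 ht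
    have h4 : s.unpair.2 = t.unpair.2 := by
      rcases lt_trichotomy s.unpair.2 t.unpair.2 with hlt | heq | hlt
      · exact absurd h2 (h3' _ hlt)
      · exact heq
      · exact absurd h2' (h3 _ hlt)
    rw [← Nat.pair_unpair s, ← Nat.pair_unpair t, ← h1, ← h1', h4]

/-- The weight `2⁻ˡ` of an enumerated pair `(b, l)`; times at which nothing is enumerated have
weight `0`. -/
noncomputable def weight (o : Option (β × ℕ)) : ℝ≥0 := o.elim 0 fun q => 2⁻¹ ^ q.2

/-- The integer `2ᵗ ∑_{s < t} 2^{-lₛ}` for an enumeration of pairs `(bₛ, lₛ)` with `lₛ ≤ s`. -/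
def scaledSum (g : ℕ → Option (β × ℕ)) (t : ℕ) : ℕ :=
  Nat.rec 0 (fun s A => 2 * (A + (g s).elim 0 fun q => 2 ^ (s - q.2))) t

theorem scaledSum_eq {g : ℕ → Option (β × ℕ)} (hg : ∀ t b l, g t = some (b, l) → l ≤ t) (t : ℕ) :
    (scaledSum g t : ℝ≥0) = 2 ^ t * ∑ s ∈ Finset.range t, weight (g s) := by
  induction t with
  | zero => simp [scaledSum]
  | succ t ih =>
    have h1 : scaledSum g (t + 1) = 2 * (scaledSum g t + (g t).elim 0 fun q => 2 ^ (t - q.2)) :=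
      rfl
    rw [h1, Finset.sum_range_succ]
    push_cast
    rw [ih]
    rcases h : g t with _ | ⟨b, l⟩
    · simp [weight, pow_succ]
      ring
    · have hl := hg t b l h
      simp only [weight, Option.elim]
      push_cast
      rw [pow_sub₀ _ (by norm_num) hl, pow_succ, inv_pow]
      ring

theorem primrec_scaledSum [Primcodable α] [Primcodable β] {g : α → ℕ → Option (β × ℕ)}
    (hg : Primrec fun q : α × ℕ => g q.1 q.2) :
    Primrec fun q : α × ℕ => scaledSum (g q.1) q.2 := by
  unfold scaledSum
  refine Primrec.nat_rec' (f := fun q : α × ℕ => q.2) (g := fun _ => 0)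
    (h := fun q p => 2 * (p.2 + (g q.1 p.1).elim 0 fun q => 2 ^ (p.1 - q.2)))
    (by fun_prop) (by fun_prop) ?_
  refine Primrec.mul' (by fun_prop) (Primrec.add' (by fun_prop) ?_)
  refine (Primrec.option_casesOn (o := fun r : (α × ℕ) × ℕ × ℕ => g r.1.1 r.2.1)
    (f := fun _ => 0) (g := fun r q => 2 ^ (r.2.1 - q.2))
    (hg.comp (f := fun q : α × ℕ => g q.1 q.2) (g := fun r : (α × ℕ) × ℕ × ℕ => (r.1.1, r.2.1))
      (by fun_prop)) (by fun_prop) ?_).of_eq ?_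
  · exact Primrec.pow' (by fun_prop) (by fun_prop)
  · intro r
    cases g r.1.1 r.2.1 <;> rfl

/-- An enumeration without repetition has the same total weight as the enumerated set. -/
theorem tsum_weight_eq {g : ℕ → Option (β × ℕ)} {R : β → ℕ → Prop}
    (h₁ : ∀ t b l, g t = some (b, l) → R b l) (h₂ : ∀ b l, R b l → ∃ t, g t = some (b, l))
    (h₃ : ∀ s t q, g s = some q → g t = some q → s = t) :
    ∑' t, (weight (g t) : ℝ≥0∞) = ∑' q : {q : β × ℕ // R q.1 q.2}, (2⁻¹ : ℝ≥0∞) ^ q.1.2 := by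
  choose! τ hτ using h₂
  have hval : ∀ q : {q : β × ℕ // R q.1 q.2},
      (weight (g (τ q.1.1 q.1.2)) : ℝ≥0∞) = 2⁻¹ ^ q.1.2 := fun q => by
    rw [hτ _ _ q.2]
    simp [weight, ENNReal.inv_pow]
  have hinj : Function.Injective fun q : {q : β × ℕ // R q.1 q.2} => τ q.1.1 q.1.2 := by
    intro q r hqr
    have h := hτ _ _ q.2
    simp only at hqr
    rw [hqr, hτ _ _ r.2] at h
    exact Subtype.ext (Option.some.inj h).symm
  simp only [← hval]
  refine (hinj.tsum_eq (f := fun t => (weight (g t) : ℝ≥0∞)) ?_).symm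
  intro t ht
  rcases h : g t with _ | ⟨b, l⟩
  · simp [h, weight] at ht
  · exact ⟨⟨(b, l), h₁ t b l h⟩, h₃ _ _ _ (hτ _ _ (h₁ t b l h)) h⟩

end Enumeration

/-! ### Kraft–Chaitin coding by dyadic intervals -/

/-- The natural number with binary expansion `p`, most significant bit first. The word `p` stands
for the dyadic interval `[binVal p / 2^|p|, (binVal p + 1) / 2^|p|)`. -/
def binVal (p : Word) : ℕ := p.foldl (fun a b => 2 * a + b.toNat) 0

theorem primrec_binVal : Primrec binVal := by
  refine Primrec.list_foldl (f := fun p : Word => p) (g := fun _ => 0)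
    (h := fun _ q => 2 * q.1 + q.2.toNat) (by fun_prop) (by fun_prop) ?_
  refine Primrec.add' (by fun_prop) ((Primrec.dom_bool Bool.toNat).comp (by fun_prop))

theorem binVal_append (p q : Word) : binVal (p ++ q) = binVal p * 2 ^ q.length + binVal q := by
  induction q using List.reverseRecOn with
  | nil => simp [binVal]
  | append_singleton q b ih =>
    rw [← List.append_assoc]
    simp only [binVal, List.foldl_append, List.foldl_cons, List.foldl_nil, List.length_append,
      List.length_singleton] at ih ⊢
    rw [ih]
    ring

theorem binVal_lt (p : Word) : binVal p < 2 ^ p.length := by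
  induction p using List.reverseRecOn with
  | nil => simp [binVal]
  | append_singleton p b ih =>
    have hb : binVal [b] < 2 := by cases b <;> simp [binVal]
    rw [binVal_append, List.length_append, List.length_singleton, pow_succ]
    omega

theorem exists_binVal_eq (n v : ℕ) (h : v < 2 ^ n) : ∃ p : Word, p.length = n ∧ binVal p = v := by
  induction n generalizing v with
  | zero => exact ⟨[], rfl, by simp [binVal]; omega⟩
  | succ n ih =>
    obtain ⟨p, hp, hv⟩ := ih (v / 2) (by omega)
    refine ⟨p ++ [v.bodd], by simp [hp], ?_⟩
    rw [binVal_append, hv]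
    have hmod := Nat.mod_two_of_bodd v
    cases hb : v.bodd <;> simp [hb] at hmod <;> simp [binVal] <;> omega

/-- Kraft–Chaitin theorem: if the requested codelengths of a semidecidable set of requests `(w, l)`
satisfy the Kraft inequality, then they are codelengths for the universal machine up to a constant.
The constant does not depend on the side input `y`: the machine is prefix-free for all side inputs,
and those for which the Kraft inequality fails only leave some requests unserved. -/
theorem IsUniversal.exists_K_le_of_kraft (hU : IsUniversal U)
    {R : Word → Word → ℕ → Prop} (hR : SemiDec fun q : Word × Word × ℕ => R q.1 q.2.1 q.2.2) :
    ∃ c : ℕ, ∀ y, ∑' q : {q : Word × ℕ // R y q.1 q.2}, (2⁻¹ : ℝ≥0∞) ^ q.1.2 ≤ 1 →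
      ∀ w l, R y w l → K U w y ≤ l + c := by
  obtain ⟨g, hg, hgR, hRg, hinj⟩ := hR.exists_enumeration
  set S : Word → ℕ → ℝ := fun y t => ∑ s ∈ Finset.range t, (weight (g y s) : ℝ) with hS
  have hsc : ∀ y t, (scaledSum (g y) t : ℝ) = 2 ^ t * S y t := by
    intro y t
    have h := scaledSum_eq (fun t b l h => (hgR y t b l h).2) t
    have := congrArg (NNReal.toReal) h
    push_cast at this
    exact this
  have hmono : ∀ y s t, s ≤ t → S y s ≤ S y t := fun y s t h =>
    Finset.sum_le_sum_of_subset_of_nonneg (Finset.range_subset_range.2 h)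
      fun _ _ _ => NNReal.coe_nonneg _
  have hsucc : ∀ y t w l, g y t = some (w, l) → S y (t + 1) = S y t + 2⁻¹ ^ l := by
    intro y t w l h
    simp [hS, Finset.sum_range_succ, h, weight]
  -- The request `(w, l)` served at time `t` owns the interval `[S t, S t + 2⁻ˡ)`; its programs are
  -- the words of length `l + 1` whose dyadic interval lies inside. An interval of length `2⁻ˡ`
  -- contains such a dyadic interval, but not always one of length `2⁻ˡ`.
  let D : Word → Word → Word → Prop := fun p y w => ∃ q : ℕ × ℕ,
    g y q.1 = some (w, q.2) ∧ p.length = q.2 + 1 ∧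
      scaledSum (g y) q.1 * 2 ^ (q.2 + 1) ≤ binVal p * 2 ^ q.1 ∧
      (binVal p + 1) * 2 ^ q.1 ≤ scaledSum (g y) q.1 * 2 ^ (q.2 + 1) + 2 * 2 ^ q.1
  have hD : ∀ p y w, D p y w → ∃ t l, g y t = some (w, l) ∧ p.length = l + 1 ∧
      S y t ≤ binVal p / 2 ^ p.length ∧ (binVal p + 1) / 2 ^ p.length ≤ S y (t + 1) := by
    rintro p y w ⟨⟨t, l⟩, h1, h2, h3, h4⟩
    refine ⟨t, l, h1, h2, ?_, ?_⟩
    · rw [le_div_iff₀ (by positivity), h2]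
      have h3' : (scaledSum (g y) t : ℝ) * 2 ^ (l + 1) ≤ binVal p * 2 ^ t := by exact_mod_cast h3
      rw [hsc] at h3'
      have : (0 : ℝ) < 2 ^ t := by positivity
      nlinarith
    · rw [div_le_iff₀ (by positivity), h2, hsucc y t w l h1]
      have h4' : ((binVal p : ℝ) + 1) * 2 ^ t ≤ scaledSum (g y) t * 2 ^ (l + 1) + 2 * 2 ^ t := by
        exact_mod_cast h4
      rw [hsc] at h4'
      have h5 : (0 : ℝ) < 2 ^ t := by positivity
      have h6 : (2⁻¹ : ℝ) ^ l * 2 ^ (l + 1) = 2 := by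
        rw [pow_succ, ← mul_assoc, ← mul_pow]
        norm_num
      rw [add_mul, h6]
      nlinarith
  have hsemi : SemiDec fun q : (Word × Word) × Word => D q.1.1 q.1.2 q.2 := by
    have hsum := primrec_scaledSum hg
    refine SemiDec.exists_snd (.and (.eq ?_ ?_) (.and (.eq ?_ ?_) (.and (.le ?_ ?_) (.le ?_ ?_))))
    · exact hg.comp (g := fun r : ((Word × Word) × Word) × ℕ × ℕ => (r.1.1.2, r.2.1)) (by fun_prop)
    · fun_prop
    · fun_prop
    · fun_prop
    · exact .mul' (hsum.comp (g := fun r : ((Word × Word) × Word) × ℕ × ℕ => (r.1.1.2, r.2.1))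
        (by fun_prop)) (by fun_prop)
    · exact .mul' (primrec_binVal.comp (by fun_prop)) (by fun_prop)
    · exact .mul' (.add' (primrec_binVal.comp (by fun_prop)) (by fun_prop)) (by fun_prop)
    · exact .add' (.mul' (hsum.comp
        (g := fun r : ((Word × Word) × Word) × ℕ × ℕ => (r.1.1.2, r.2.1)) (by fun_prop))
        (by fun_prop)) (by fun_prop)
  obtain ⟨c, hc⟩ := hU.exists_K_le hsemi (by
    intro y p q v w hp hq hpq
    obtain ⟨t, l, h1, h2, h3, h4⟩ := hD p y v hp
    obtain ⟨t', l', h1', h2', h3', h4'⟩ := hD q y w hq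
    obtain ⟨r, rfl⟩ := hpq
    have hlow : (binVal p : ℝ) / 2 ^ p.length ≤ binVal (p ++ r) / 2 ^ (p ++ r).length := by
      rw [div_le_div_iff₀ (by positivity) (by positivity), binVal_append, List.length_append,
        pow_add]
      push_cast
      have : (0 : ℝ) ≤ binVal r * 2 ^ p.length := by positivity
      nlinarith
    have hhigh : (binVal (p ++ r) : ℝ) / 2 ^ (p ++ r).length < (binVal p + 1) / 2 ^ p.length := by
      rw [div_lt_div_iff₀ (by positivity) (by positivity), binVal_append, List.length_append,
        pow_add]
      have h5 : (binVal r : ℝ) < 2 ^ r.length := by exact_mod_cast binVal_lt r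
      push_cast
      have : (0 : ℝ) < 2 ^ p.length := by positivity
      nlinarith
    have hself : (binVal (p ++ r) : ℝ) / 2 ^ (p ++ r).length
        ≤ (binVal (p ++ r) + 1) / 2 ^ (p ++ r).length := by gcongr; linarith
    have htt : t = t' := by
      rcases lt_trichotomy t t' with hlt | heq | hlt
      · have := hmono y _ _ (Nat.succ_le_of_lt hlt)
        linarith
      · exact heq
      · have := hmono y _ _ (Nat.succ_le_of_lt hlt)
        have h7 : (binVal (p ++ r) : ℝ) / 2 ^ (p ++ r).length
            < (binVal (p ++ r) + 1) / 2 ^ (p ++ r).length := by gcongr; linarith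
        linarith
    subst htt
    rw [h1] at h1'
    obtain ⟨rfl, rfl⟩ := Prod.mk.inj (Option.some.inj h1')
    have : r = [] := by
      rw [List.length_append] at h2'
      exact List.length_eq_zero_iff.1 (by omega)
    simp [this])
  refine ⟨1 + c, fun y hy w l hw => ?_⟩
  obtain ⟨t, ht⟩ := hRg y w l hw
  have hle : S y (t + 1) ≤ 1 := by
    rw [← tsum_weight_eq (fun t b l h => (hgR y t b l h).1) (hRg y) (hinj y)] at hy
    have h1 := (ENNReal.sum_le_tsum (Finset.range (t + 1))).trans hy
    have h2 : ∑ s ∈ Finset.range (t + 1), weight (g y s) ≤ 1 := by exact_mod_cast h1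
    simp only [hS]
    exact_mod_cast h2
  rw [hsucc y t w l ht] at hle
  have hS0 : 0 ≤ S y t := Finset.sum_nonneg fun _ _ => NNReal.coe_nonneg _
  have h6 : (2⁻¹ : ℝ) ^ l * 2 ^ (l + 1) = 2 := by
    rw [pow_succ, ← mul_assoc, ← mul_pow]
    norm_num
  have h7 : (0 : ℝ) < 2 ^ (l + 1) := by positivity
  have h8 : (0 : ℝ) < 2 ^ t := by positivity
  set v : ℕ := ⌈S y t * 2 ^ (l + 1)⌉₊ with hv
  have hv1 : S y t * 2 ^ (l + 1) ≤ v := Nat.le_ceil _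
  have hv2 : (v : ℝ) < S y t * 2 ^ (l + 1) + 1 := Nat.ceil_lt_add_one (by positivity)
  have hv3 : v < 2 ^ (l + 1) := by
    have : (v : ℝ) < 2 ^ (l + 1) := by nlinarith
    exact_mod_cast this
  obtain ⟨p, hp, hpv⟩ := exists_binVal_eq (l + 1) v hv3
  obtain ⟨q, hq, hql⟩ := hc p y w ⟨(t, l), ht, hp, by
    rw [hpv]
    have : (scaledSum (g y) t : ℝ) * 2 ^ (l + 1) ≤ v * 2 ^ t := by
      rw [hsc]
      nlinarith
    exact_mod_cast this, by
    rw [hpv]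
    have : ((v : ℝ) + 1) * 2 ^ t ≤ scaledSum (g y) t * 2 ^ (l + 1) + 2 * 2 ^ t := by
      rw [hsc]
      nlinarith
    exact_mod_cast this⟩
  have := K_le hq
  omega

/-! ### The coding theorem and the chain rule -/

theorem IsPrefixMachine.uniquelyDecodable {V : Word → Word →. Word} (hV : IsPrefixMachine V)
    (y : Word) {S : Set Word} (hS : ∀ p ∈ S, (V p y).Dom) (hnil : [] ∉ S) :
    InformationTheory.UniquelyDecodable S := by
  intro l
  induction l with
  | nil =>
    intro m _ hm h
    cases m with
    | nil => rfl
    | cons q m =>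
      obtain rfl : q = [] := by
        have := h.symm
        simp only [List.flatten_nil, List.flatten_cons, List.append_eq_nil_iff] at this
        exact this.1
      exact absurd (hm _ (by simp)) hnil
  | cons p l ih =>
    intro m hl hm h
    cases m with
    | nil =>
      obtain rfl : p = [] := by
        simp only [List.flatten_nil, List.flatten_cons, List.append_eq_nil_iff] at h
        exact h.1
      exact absurd (hl _ (by simp)) hnil
    | cons q m =>
      simp only [List.flatten_cons] at h
      obtain ⟨v, hv⟩ := Part.dom_iff_mem.1 (hS p (hl _ (by simp)))
      obtain ⟨w, hw⟩ := Part.dom_iff_mem.1 (hS q (hm _ (by simp)))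
      obtain ⟨rfl, -, -⟩ := hV.parse hv hw (by rw [h])
      rw [ih m (fun r hr => hl r (by simp [hr])) (fun r hr => hm r (by simp [hr]))
        (List.append_cancel_left h)]

/-- The Kraft inequality for the programs of a prefix-free machine. -/
theorem IsPrefixMachine.tsum_le_one {V : Word → Word →. Word} (hV : IsPrefixMachine V)
    (y : Word) : ∑' p : {p : Word // (V p y).Dom}, (2⁻¹ : ℝ≥0∞) ^ p.1.length ≤ 1 := by
  classical
  rw [ENNReal.tsum_eq_iSup_sum]
  refine iSup_le fun s => ?_
  have hmem : ∀ p ∈ s.map (Function.Embedding.subtype _), (V p y).Dom := by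
    intro p hp
    obtain ⟨q, -, rfl⟩ := Finset.mem_map.1 hp
    exact q.2
  rw [show ∑ p ∈ s, (2⁻¹ : ℝ≥0∞) ^ p.1.length
    = ∑ p ∈ s.map (Function.Embedding.subtype _), (2⁻¹ : ℝ≥0∞) ^ p.length by simp]
  generalize s.map (Function.Embedding.subtype _) = S at hmem
  by_cases hnil : [] ∈ S
  · have : S = {[]} := by
      refine Finset.eq_singleton_iff_unique_mem.2 ⟨hnil, fun p hp => ?_⟩
      exact (hV.2 y [] p (hmem _ hnil) (hmem _ hp) List.nil_prefix).symm
    simp [this]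
  · have h := InformationTheory.kraft_mcmillan_inequality
      (hV.uniquelyDecodable y (S := (S : Set Word)) hmem (by simpa using hnil))
    have h' : ∑ p ∈ S, (2⁻¹ : NNReal) ^ p.length ≤ 1 := by
      rw [← NNReal.coe_le_coe]
      push_cast
      simpa using h
    have h2 : ((2⁻¹ : NNReal) : ℝ≥0∞) = 2⁻¹ := by simp
    rw [← h2]
    exact_mod_cast h'

/-- The powers `2⁻ᵏ` below `m` form the tail of a geometric series, so their halves sum to at most
`m`. -/
theorem tsum_inv_two_pow_succ_le (m : ℝ≥0∞) :
    ∑' k : {k : ℕ // (2⁻¹ : ℝ≥0∞) ^ k < m}, (2⁻¹ : ℝ≥0∞) ^ (k.1 + 1) ≤ m := by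
  classical
  by_cases hm : ∃ k : ℕ, (2⁻¹ : ℝ≥0∞) ^ k < m
  · calc ∑' k : {k : ℕ // (2⁻¹ : ℝ≥0∞) ^ k < m}, (2⁻¹ : ℝ≥0∞) ^ (k.1 + 1)
        = ∑' k : {k : ℕ // (2⁻¹ : ℝ≥0∞) ^ k < m},
            (2⁻¹ : ℝ≥0∞) ^ (Nat.find hm + (k.1 - Nat.find hm + 1)) := by
          refine tsum_congr fun k => ?_
          have := Nat.find_min' hm k.2
          congr 1
          omega
      _ ≤ ∑' i : ℕ, (2⁻¹ : ℝ≥0∞) ^ (Nat.find hm + (i + 1)) := by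
          refine ENNReal.tsum_comp_le_tsum_of_injective (f := fun k :
            {k : ℕ // (2⁻¹ : ℝ≥0∞) ^ k < m} => k.1 - Nat.find hm) ?_
            fun i => (2⁻¹ : ℝ≥0∞) ^ (Nat.find hm + (i + 1))
          intro k l hkl
          have h1 := Nat.find_min' hm k.2
          have h2 := Nat.find_min' hm l.2
          simp only at hkl
          exact Subtype.ext (by omega)
      _ = (2⁻¹ : ℝ≥0∞) ^ Nat.find hm := by
          simp_rw [pow_add _ (Nat.find hm)]
          rw [ENNReal.tsum_mul_left, ENNReal.tsum_geometric_add_one, ENNReal.one_sub_inv_two,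
            inv_inv, ENNReal.inv_mul_cancel (by simp) (by simp), mul_one]
      _ ≤ m := (Nat.find_spec hm).le
  · have : IsEmpty {k : ℕ // (2⁻¹ : ℝ≥0∞) ^ k < m} := ⟨fun k => hm ⟨_, k.2⟩⟩
    simp

/-- The coding theorem: if lower bounds `2⁻ᵏ < m w` for a semimeasure `m` are semidecidable, then
they yield upper bounds for the complexity. -/
theorem IsUniversal.exists_K_le_of_lt (hU : IsUniversal U) {T : Word → Word → ℕ → Prop}
    (hT : SemiDec fun q : Word × Word × ℕ => T q.1 q.2.1 q.2.2) :
    ∃ c : ℕ, ∀ (y : Word) (m : Word → ℝ≥0∞), ∑' w, m w ≤ 1 →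
      (∀ w k, T y w k → 2⁻¹ ^ k < m w) → ∀ w k, T y w k → K U w y ≤ k + c := by
  obtain ⟨c, hc⟩ := hU.exists_K_le_of_kraft (R := fun y w l => ∃ k, l = k + 1 ∧ T y w k) (by
    refine SemiDec.exists_snd (.and (.eq (by fun_prop) (by fun_prop)) ?_)
    exact hT.comp (f := fun r : (Word × Word × ℕ) × ℕ => (r.1.1, r.1.2.1, r.2)) (by fun_prop))
  refine ⟨1 + c, fun y m hm hTm w k hk => ?_⟩
  have := hc y ?_ w (k + 1) ⟨k, rfl, hk⟩
  · omega
  refine le_trans ?_ hm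
  calc ∑' q : {q : Word × ℕ // ∃ k, q.2 = k + 1 ∧ T y q.1 k}, (2⁻¹ : ℝ≥0∞) ^ q.1.2
      ≤ ∑' s : (w : Word) × {k : ℕ // (2⁻¹ : ℝ≥0∞) ^ k < m w}, (2⁻¹ : ℝ≥0∞) ^ (s.2.1 + 1) := by
        have hT' : ∀ q : {q : Word × ℕ // ∃ k, q.2 = k + 1 ∧ T y q.1 k},
            q.1.2 = q.1.2 - 1 + 1 ∧ (2⁻¹ : ℝ≥0∞) ^ (q.1.2 - 1) < m q.1.1 := by
          intro q
          obtain ⟨k, hl, hk⟩ := q.2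
          exact ⟨by omega, by rw [hl]; exact hTm _ k hk⟩
        let f : {q : Word × ℕ // ∃ k, q.2 = k + 1 ∧ T y q.1 k} →
            (w : Word) × {k : ℕ // (2⁻¹ : ℝ≥0∞) ^ k < m w} :=
          fun q => ⟨q.1.1, q.1.2 - 1, (hT' q).2⟩
        have hf : Function.Injective f := by
          intro q r hqr
          have h1 : q.1.1 = r.1.1 := congrArg Sigma.fst hqr
          have h2 : q.1.2 - 1 = r.1.2 - 1 :=
            congrArg (fun s : (w : Word) × {k : ℕ // (2⁻¹ : ℝ≥0∞) ^ k < m w} => s.2.1) hqr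
          exact Subtype.ext (Prod.ext h1 (by rw [(hT' q).1, (hT' r).1, h2]))
        refine le_trans (le_of_eq (tsum_congr fun q => ?_))
          (ENNReal.tsum_comp_le_tsum_of_injective hf _)
        exact congrArg _ (hT' q).1
    _ = ∑' w, ∑' k : {k : ℕ // (2⁻¹ : ℝ≥0∞) ^ k < m w}, (2⁻¹ : ℝ≥0∞) ^ (k.1 + 1) :=
        ENNReal.tsum_sigma' _
    _ ≤ ∑' w, m w := ENNReal.tsum_le_tsum fun w => tsum_inv_two_pow_succ_le (m w)

/-- Sums of weights over semidecidable sets are lower semicomputable. -/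
theorem SemiDec.lt_tsum {α β : Type*} [Primcodable α] [Primcodable β] {R : α → β → ℕ → Prop}
    (hR : SemiDec fun q : α × β × ℕ => R q.1 q.2.1 q.2.2) :
    SemiDec fun q : α × ℕ =>
      (2⁻¹ : ℝ≥0∞) ^ q.2 < ∑' r : {r : β × ℕ // R q.1 r.1 r.2}, (2⁻¹ : ℝ≥0∞) ^ r.1.2 := by
  obtain ⟨g, hg, hgR, hRg, hinj⟩ := hR.exists_enumeration
  have hsemi : SemiDec fun q : α × ℕ => ∃ t, 2 ^ t < scaledSum (g q.1) t * 2 ^ q.2 := by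
    refine SemiDec.exists_snd (.lt (by fun_prop) (.mul' ?_ (by fun_prop)))
    exact (primrec_scaledSum hg).comp (g := fun r : (α × ℕ) × ℕ => (r.1.1, r.2)) (by fun_prop)
  refine hsemi.of_eq fun ⟨a, k⟩ => ?_
  rw [← tsum_weight_eq (fun t b l h => (hgR a t b l h).1) (hRg a) (hinj a),
    ENNReal.tsum_eq_iSup_nat, lt_iSup_iff]
  refine exists_congr fun t => ?_
  have h1 := scaledSum_eq (fun t b l h => (hgR a t b l h).2) t
  have h2 : (2⁻¹ : ℝ≥0∞) ^ k < ∑ s ∈ Finset.range t, (weight (g a s) : ℝ≥0∞) ↔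
      (2⁻¹ : NNReal) ^ k < ∑ s ∈ Finset.range t, weight (g a s) := by
    rw [← ENNReal.coe_lt_coe]
    push_cast
    simp
  rw [h2]
  have h3 : 2 ^ t < scaledSum (g a) t * 2 ^ k ↔
      (2 : NNReal) ^ t * 1 < 2 ^ t * ((∑ s ∈ Finset.range t, weight (g a s)) * 2 ^ k) := by
    rw [← mul_assoc, ← h1]
    norm_cast
    simp
  rw [h3, mul_lt_mul_iff_right₀ (by positivity), inv_pow,
    inv_lt_iff_one_lt_mul₀ (by positivity)]

/-- The probability that a random program outputs the pair `(a, b)`. -/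
noncomputable def pairMass (U : Word → Word →. Word) (a b : Word) : ℝ≥0∞ :=
  ∑' p : {p : Word // tuple [a, b] ∈ U p []}, (2⁻¹ : ℝ≥0∞) ^ p.1.length

theorem tsum_pairMass_eq (b : Word) : ∑' a, pairMass U a b =
    ∑' s : (a : Word) × {p : Word // tuple [a, b] ∈ U p []}, (2⁻¹ : ℝ≥0∞) ^ s.2.1.length :=
  (ENNReal.tsum_sigma' fun s : (a : Word) × {p : Word // tuple [a, b] ∈ U p []} =>
    (2⁻¹ : ℝ≥0∞) ^ s.2.1.length).symm

theorem IsPrefixMachine.tsum_pairMass_le (hU : IsPrefixMachine U) :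
    ∑' b, ∑' a, pairMass U a b ≤ 1 := by
  simp only [tsum_pairMass_eq]
  rw [← ENNReal.tsum_sigma' fun s : (b : Word) × (a : Word) × {p : Word // tuple [a, b] ∈ U p []} =>
    (2⁻¹ : ℝ≥0∞) ^ s.2.2.1.length]
  refine le_trans ?_ (hU.tsum_le_one [])
  let f : ((b : Word) × (a : Word) × {p : Word // tuple [a, b] ∈ U p []}) →
      {p : Word // (U p []).Dom} :=
    fun s => ⟨s.2.2.1, Part.dom_iff_mem.2 ⟨_, s.2.2.2⟩⟩
  refine ENNReal.tsum_comp_le_tsum_of_injective (f := f) ?_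
    fun p => (2⁻¹ : ℝ≥0∞) ^ p.1.length
  rintro ⟨b, a, p, hp⟩ ⟨b', a', p', hp'⟩ h
  obtain rfl : p = p' := congrArg Subtype.val h
  have := tuple_injective (Part.mem_unique hp hp')
  obtain ⟨rfl, rfl⟩ : a = a' ∧ b = b' := by simpa using this
  rfl

/-- The coding theorem for the second component of a pair. -/
theorem IsUniversal.exists_K_le_of_lt_tsum_pairMass (hU : IsUniversal U) :
    ∃ c : ℕ, ∀ (b : Word) (k : ℕ), 2⁻¹ ^ k < ∑' a, pairMass U a b → K U b [] ≤ k + c := by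
  have hR : SemiDec fun q : Word × (Word × Word) × ℕ =>
      tuple [q.2.1.1, q.1] ∈ U q.2.1.2 [] ∧ q.2.2 = q.2.1.2.length :=
    .and (.machine hU.1 (by fun_prop) (by fun_prop) (by fun_prop)) (.eq (by fun_prop) (by fun_prop))
  have hmass : ∀ b, ∑' r : {r : (Word × Word) × ℕ //
      tuple [r.1.1, b] ∈ U r.1.2 [] ∧ r.2 = r.1.2.length}, (2⁻¹ : ℝ≥0∞) ^ r.1.2
        = ∑' a, pairMass U a b := by
    intro b
    rw [tsum_pairMass_eq]
    let e : {r : (Word × Word) × ℕ // tuple [r.1.1, b] ∈ U r.1.2 [] ∧ r.2 = r.1.2.length} ≃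
        (a : Word) × {p : Word // tuple [a, b] ∈ U p []} :=
      { toFun := fun r => ⟨r.1.1.1, r.1.1.2, r.2.1⟩
        invFun := fun s => ⟨((s.1, s.2.1), s.2.1.length), s.2.2, rfl⟩
        left_inv := fun r => Subtype.ext (Prod.ext rfl r.2.2.symm)
        right_inv := fun s => rfl }
    rw [← e.tsum_eq]
    exact tsum_congr fun r => congrArg _ r.2.2
  have hlt := SemiDec.lt_tsum (R := fun (b : Word) (q : Word × Word) (l : ℕ) =>
    tuple [q.1, b] ∈ U q.2 [] ∧ l = q.2.length) hR
  simp only [hmass] at hlt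
  obtain ⟨c, hc⟩ := hU.exists_K_le_of_lt
    (T := fun _ b k => (2⁻¹ : ℝ≥0∞) ^ k < ∑' a, pairMass U a b)
    (hlt.comp (f := fun q : Word × Word × ℕ => q.2) (by fun_prop))
  exact ⟨c, fun b k h => hc [] _ hU.1.tsum_pairMass_le (fun _ _ h => h) b k h⟩

/-- The hard half of the chain rule for prefix complexity. -/
theorem IsUniversal.exists_le_K_pair (hU : IsUniversal U) :
    ∃ c : ℕ, ∀ a b : Word,
      K U b [] + K U a (shortestProgram U b) ≤ K U (tuple [a, b]) [] + c := by
  obtain ⟨c₀, hc₀⟩ := hU.exists_K_le_of_lt_tsum_pairMass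
  -- A program `p` for `(a, b)` turns into a description of `a` given `q = b*` that is shorter by
  -- `|q|`; the coding theorem for `b` says that these descriptions satisfy the Kraft inequality.
  obtain ⟨c₁, hc₁⟩ := hU.exists_K_le_of_lt (T := fun q a l => ∃ s : Word × Word,
      s.2 ∈ U q [] ∧ tuple [a, s.2] ∈ U s.1 [] ∧ s.1.length + c₀ + 2 = l + q.length) (by
    refine SemiDec.exists_snd (.and (.machine hU.1 ?_ ?_ ?_) (.and (.machine hU.1 ?_ ?_ ?_)
      (.eq ?_ ?_))) <;> fun_prop)
  have hpair : ∀ a b p, tuple [a, b] ∈ U p [] → (2⁻¹ : ℝ≥0∞) ^ p.length ≤ pairMass U a b :=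
    fun a b p hp => ENNReal.le_tsum
      (f := fun p : {p : Word // tuple [a, b] ∈ U p []} => (2⁻¹ : ℝ≥0∞) ^ p.1.length) ⟨p, hp⟩
  have hhalf : ∀ l : ℕ, (2⁻¹ : ℝ≥0∞) ^ (l + 1) < 2⁻¹ ^ l := fun l => by
    rw [pow_succ, ← div_eq_mul_inv]
    exact ENNReal.half_lt_self (by simp) (by simp)
  refine ⟨c₀ + 2 + c₁, fun a b => ?_⟩
  obtain ⟨hq, hql⟩ := hU.shortestProgram_spec b
  set q := shortestProgram U b
  have hbound : (2 : ℝ≥0∞) ^ q.length * ∑' a, pairMass U a b ≤ 2 ^ (c₀ + 1) := by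
    rcases Nat.lt_or_ge q.length (c₀ + 1) with hlt | hge
    · calc (2 : ℝ≥0∞) ^ q.length * ∑' a, pairMass U a b ≤ 2 ^ (c₀ + 1) * 1 := by
            gcongr
            · exact one_le_two
            · exact (ENNReal.le_tsum b).trans hU.1.tsum_pairMass_le
        _ = 2 ^ (c₀ + 1) := mul_one _
    · have h1 : ∑' a, pairMass U a b ≤ 2⁻¹ ^ (q.length - (c₀ + 1)) := by
        by_contra hlt
        have := hc₀ b _ (not_le.1 hlt)
        omega
      calc (2 : ℝ≥0∞) ^ q.length * ∑' a, pairMass U a b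
          ≤ 2 ^ q.length * 2⁻¹ ^ (q.length - (c₀ + 1)) := by gcongr
        _ = 2 ^ (c₀ + 1) * (2 ^ (q.length - (c₀ + 1)) * 2⁻¹ ^ (q.length - (c₀ + 1))) := by
            rw [← mul_assoc, ← pow_add]
            congr 2
            omega
        _ = 2 ^ (c₀ + 1) := by
            rw [← mul_pow, ENNReal.mul_inv_cancel (by simp) (by simp), one_pow, mul_one]
  obtain ⟨p, hp, hpl⟩ := hU.exists_K_eq (tuple [a, b]) []
  have hqp : q.length ≤ p.length + 1 + c₀ := by
    rw [hql]
    refine hc₀ b _ ((hhalf _).trans_le ((hpair a b p hp).trans ?_))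
    exact ENNReal.le_tsum a
  have := hc₁ q (fun a => 2 ^ q.length * 2⁻¹ ^ (c₀ + 1) * pairMass U a b) ?_ ?_ a
    (p.length + c₀ + 2 - q.length) ⟨(p, b), hq, hp, by simp only; omega⟩
  · omega
  · rw [ENNReal.tsum_mul_left, mul_right_comm]
    calc (2 : ℝ≥0∞) ^ q.length * (∑' a, pairMass U a b) * 2⁻¹ ^ (c₀ + 1)
        ≤ 2 ^ (c₀ + 1) * 2⁻¹ ^ (c₀ + 1) := by gcongr
      _ = 1 := by rw [← mul_pow, ENNReal.mul_inv_cancel (by simp) (by simp), one_pow]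
  · rintro a' l ⟨⟨p', b'⟩, hb', hp', hl⟩
    obtain rfl := Part.mem_unique hq hb'
    simp only at hl
    calc (2⁻¹ : ℝ≥0∞) ^ l = 2 ^ q.length * 2⁻¹ ^ q.length * 2⁻¹ ^ l := by
          rw [← mul_pow, ENNReal.mul_inv_cancel (by simp) (by simp), one_pow, one_mul]
      _ = 2 ^ q.length * 2⁻¹ ^ (c₀ + 1) * 2⁻¹ ^ (p'.length + 1) := by
          rw [mul_assoc, mul_assoc, ← pow_add, ← pow_add]
          congr 2
          omega
      _ < 2 ^ q.length * 2⁻¹ ^ (c₀ + 1) * 2⁻¹ ^ p'.length :=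
          ENNReal.mul_lt_mul_right (by simp) (by finiteness) (hhalf _)
      _ ≤ 2 ^ q.length * 2⁻¹ ^ (c₀ + 1) * pairMass U a' b := by
          gcongr
          exact hpair _ _ _ hp'

/-! ### The joint distribution of a causal network -/

theorem IsAcyclic.exists_sink {V : Type} [Finite V] {G : Digraph V} (hG : IsAcyclic G)
    {s : Finset V} (hs : s.Nonempty) : ∃ v ∈ s, ∀ u ∈ s, ¬ G.Adj v u := by
  have : Std.Irrefl (Function.swap (Relation.TransGen G.Adj)) := ⟨hG⟩
  have : IsTrans V (Function.swap (Relation.TransGen G.Adj)) := ⟨fun _ _ _ h h' => h'.trans h⟩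
  obtain ⟨v, hv, hmin⟩ := (Finite.wellFounded_of_trans_of_irrefl
    (Function.swap (Relation.TransGen G.Adj))).has_min (s : Set V) hs
  exact ⟨v, hv, fun u hu h => hmin u hu (Relation.TransGen.single h)⟩

namespace CausalNetwork

variable {n : ℕ} (N : CausalNetwork U n)

theorem condProb_update_of_notMem {x : Fin n → Word} {v j : Fin n} (a : Word) (hj : j ≠ v)
    (hv : ¬ N.graph.Adj v j) : N.condProb (Function.update x v a) j = N.condProb x j := by
  unfold condProb
  rw [Function.update_of_ne hj]
  congr 1
  congr 1
  funext i
  refine Function.update_of_ne ?_ _ _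
  intro h
  exact hv (h ▸ (mem_parents _ _ _).1 i.2)

theorem tsum_condProb_update (x : Fin n → Word) (v : Fin n) :
    ∑' a, N.condProb (Function.update x v a) v = 1 := by
  rw [← PMF.tsum_coe (N.mechanism v fun i => x i)]
  refine tsum_congr fun a => ?_
  unfold condProb
  rw [Function.update_self]
  congr 1
  congr 1
  funext i
  refine Function.update_of_ne ?_ _ _
  intro h
  have hadj := (mem_parents _ _ _).1 i.2
  rw [h] at hadj
  exact N.acyclic v (Relation.TransGen.single hadj)

/-- Summing the mechanisms over the values at `s`, the other values being those of `x₀`, gives at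
most `1`: remove sinks one by one. -/
theorem tsum_prod_condProb_le (s : Finset (Fin n)) (x₀ : Fin n → Word) :
    ∑' x : {x : Fin n → Word // ∀ i ∉ s, x i = x₀ i}, ∏ j ∈ s, N.condProb x.1 j ≤ 1 := by
  classical
  induction hm : s.card generalizing s with
  | zero =>
    obtain rfl := Finset.card_eq_zero.1 hm
    have : Subsingleton {x : Fin n → Word // ∀ i ∉ (∅ : Finset (Fin n)), x i = x₀ i} :=
      ⟨fun x y => Subtype.ext (funext fun i => by rw [x.2 i (by simp), y.2 i (by simp)])⟩
    rw [tsum_eq_single ⟨x₀, fun _ _ => rfl⟩ fun y hy => absurd (Subsingleton.elim _ _) hy]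
    simp
  | succ m ih =>
    obtain ⟨v, hv, hsink⟩ := N.acyclic.exists_sink (s := s) (Finset.card_pos.1 (by omega))
    have hnot : ∀ i, i ∉ s.erase v → i ≠ v → i ∉ s := fun i h1 h2 h3 =>
      h1 (Finset.mem_erase.2 ⟨h2, h3⟩)
    have hrest : ∀ (x : Fin n → Word) (a : Word),
        ∏ j ∈ s.erase v, N.condProb (Function.update x v a) j
          = ∏ j ∈ s.erase v, N.condProb x j := fun x a =>
      Finset.prod_congr rfl fun j hj =>
        N.condProb_update_of_notMem a (Finset.ne_of_mem_erase hj)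
          (hsink j (Finset.mem_of_mem_erase hj))
    -- `f` splits off the value at `v`, and `F` is the summand in terms of the two parts.
    let F : {x : Fin n → Word // ∀ i ∉ s.erase v, x i = x₀ i} × Word → ℝ≥0∞ := fun q =>
      N.condProb (Function.update q.1.1 v q.2) v * ∏ j ∈ s.erase v, N.condProb q.1.1 j
    let f : {x : Fin n → Word // ∀ i ∉ s, x i = x₀ i} →
        {x : Fin n → Word // ∀ i ∉ s.erase v, x i = x₀ i} × Word := fun x =>
      (⟨Function.update x.1 v (x₀ v), fun i hi => by
        rcases eq_or_ne i v with rfl | hiv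
        · simp
        · rw [Function.update_of_ne hiv]
          exact x.2 i (hnot i hi hiv)⟩, x.1 v)
    have hf : Function.Injective f := by
      intro x y hxy
      have h1 : Function.update x.1 v (x₀ v) = Function.update y.1 v (x₀ v) :=
        congrArg (fun q => q.1.1) hxy
      have h2 : x.1 v = y.1 v := congrArg Prod.snd hxy
      refine Subtype.ext (funext fun i => ?_)
      rcases eq_or_ne i v with rfl | hiv
      · exact h2
      · have := congrFun h1 i
        rwa [Function.update_of_ne hiv, Function.update_of_ne hiv] at this
    calc ∑' x : {x : Fin n → Word // ∀ i ∉ s, x i = x₀ i}, ∏ j ∈ s, N.condProb x.1 j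
        = ∑' x, F (f x) := by
          refine tsum_congr fun x => ?_
          simp only [F, f, hrest, Function.update_idem, Function.update_eq_self]
          exact (Finset.mul_prod_erase s _ hv).symm
      _ ≤ ∑' q, F q := ENNReal.tsum_comp_le_tsum_of_injective hf F
      _ = ∑' x : {x : Fin n → Word // ∀ i ∉ s.erase v, x i = x₀ i},
            ∏ j ∈ s.erase v, N.condProb x.1 j := by
          rw [ENNReal.tsum_prod']
          refine tsum_congr fun x => ?_
          simp only [F]
          rw [ENNReal.tsum_mul_right, tsum_condProb_update, one_mul]
      _ ≤ 1 := ih _ (by rw [Finset.card_erase_of_mem hv]; omega)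

theorem tsum_joint_le : ∑' x, N.joint x ≤ 1 := by
  have h := N.tsum_prod_condProb_le Finset.univ fun _ => []
  have e : ∑' x : {x : Fin n → Word // ∀ i ∉ (Finset.univ : Finset (Fin n)), x i = []},
      N.joint x.1 = ∑' x, N.joint x :=
    (Equiv.subtypeUnivEquiv (p := fun x : Fin n → Word =>
      ∀ i ∉ (Finset.univ : Finset (Fin n)), x i = []) (by simp)).tsum_eq N.joint
  rw [← e]
  exact h

theorem marginal_le_one (i : Fin n) (a : Word) : N.marginal i a ≤ 1 :=
  (ENNReal.tsum_comp_le_tsum_of_injective Subtype.val_injective N.joint).trans N.tsum_joint_le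

theorem joint_le_marginal (x : Fin n → Word) (i : Fin n) : N.joint x ≤ N.marginal i (x i) :=
  ENNReal.le_tsum (f := fun y : {y : Fin n → Word // y i = x i} => N.joint y) ⟨x, rfl⟩

theorem condProb_le_one (x : Fin n → Word) (j : Fin n) : N.condProb x j ≤ 1 :=
  PMF.coe_le_one _ _

end CausalNetwork

/-! ### Coding of the observations relative to one of them -/

theorem tupleOn_univ_injective {V : Type} [Fintype V] [LinearOrder V] {w w' : V → Word}
    (h : tupleOn w Finset.univ = tupleOn w' Finset.univ) : w = w' := by
  funext v
  exact List.map_inj_left.1 (tuple_injective h) v (by simp)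

theorem primrec_tupleOn {α : Type*} [Primcodable α] {n : ℕ} {f : α → Fin n → Word}
    (hf : Primrec f) (s : Finset (Fin n)) : Primrec fun a => tupleOn (f a) s :=
  primrec_tuple (Primrec.map_const_list _ fun i => hf.fin_app' i)

theorem primrec_replicate {α : Type*} [Primcodable α] {f : α → ℕ} (hf : Primrec f) :
    Primrec fun a => List.replicate (f a) true :=
  (Primrec.list_map (f := fun a => List.range (f a)) (g := fun _ _ => true)
    (Primrec.list_range.comp hf) (Primrec.const true)).of_eq fun a => by simp

/-- The certificates of Shannon–Fano coding: `SFCode U pa i y w L` says that approximations with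
some precision `2⁻ᵏ` of the mechanisms and of the marginal distribution of the node `i`, whose
programs are listed in `y`, certify that the observations listed in `w` have probability more than
`2^{-L}` given the value at `i`. An approximation `r` of a probability `p` is used through `(r -
1) / 2ᵏ ≤ p ≤ (r + 1) / 2ᵏ`; truncated subtraction is harmless, since a vanishing factor makes the
inequality fail. -/
def SFCode (U : Word → Word →. Word) {n : ℕ} (pa : Fin n → Finset (Fin n)) (i : Fin n)
    (y w : Word) (L : ℕ) : Prop :=
  ∃ t : ((Fin n → Word) × (Fin n → Word) × Word) × (Fin n → Word) × Word × ℕ,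
    y = tuple [tupleOn t.1.1 Finset.univ, t.1.2.2, t.1.2.1 i] ∧
    w = tupleOn t.1.2.1 Finset.univ ∧
    (∀ j, t.2.1 j ∈ U (t.1.1 j)
      (tuple [tupleOn t.1.2.1 (pa j), t.1.2.1 j, List.replicate t.2.2.2 true])) ∧
    t.2.2.1 ∈ U t.1.2.2 (tuple [[], t.1.2.1 i, List.replicate t.2.2.2 true]) ∧
    (t.2.2.1.length + 1) * 2 ^ (t.2.2.2 * n)
      < 2 ^ L * 2 ^ t.2.2.2 * ∏ j, ((t.2.1 j).length - 1)

theorem semiDec_sfCode (hU : IsPrefixMachine U) {n : ℕ} (pa : Fin n → Finset (Fin n))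
    (i : Fin n) : SemiDec fun q : Word × Word × ℕ => SFCode U pa i q.1 q.2.1 q.2.2 := by
  unfold SFCode
  have hM : Primrec fun r : (Word × Word × ℕ) × ((Fin n → Word) × (Fin n → Word) × Word) ×
      (Fin n → Word) × Word × ℕ => r.2.1.1 := by fun_prop
  have hX : Primrec fun r : (Word × Word × ℕ) × ((Fin n → Word) × (Fin n → Word) × Word) ×
      (Fin n → Word) × Word × ℕ => r.2.1.2.1 := by fun_prop
  have hR : Primrec fun r : (Word × Word × ℕ) × ((Fin n → Word) × (Fin n → Word) × Word) ×
      (Fin n → Word) × Word × ℕ => r.2.2.1 := by fun_prop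
  have hk : Primrec fun r : (Word × Word × ℕ) × ((Fin n → Word) × (Fin n → Word) × Word) ×
      (Fin n → Word) × Word × ℕ => List.replicate r.2.2.2.2 true :=
    primrec_replicate (by fun_prop)
  have hMj := fun j => hM.fin_app' j
  have hXj := fun j => hX.fin_app' j
  have hRj := fun j => hR.fin_app' j
  have hMu := primrec_tupleOn hM Finset.univ
  have hXu := primrec_tupleOn hX Finset.univ
  have hXp := fun j => primrec_tupleOn hX (pa j)
  refine SemiDec.exists_snd (.and (.eq (by fun_prop) ?_) (.and (.eq (by fun_prop) hXu)
    (.and (.forall_fin fun j => .machine hU (hMj j) ?_ (hRj j)) (.and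
    (.machine hU (by fun_prop) ?_ (by fun_prop)) (.lt (by fun_prop)
      (.mul' (by fun_prop) (Primrec.fin_prod fun j => ?_)))))))
  · exact primrec_tuple (hMu.cons' (.cons' (by fun_prop) ((hXj i).cons' (Primrec.const _))))
  · exact primrec_tuple ((hXp j).cons' ((hXj j).cons' (hk.cons' (Primrec.const _))))
  · exact primrec_tuple ((Primrec.const _).cons' ((hXj i).cons' (hk.cons' (Primrec.const _))))
  · exact .sub' (hRj j).length' (Primrec.const 1)

variable {n : ℕ}

open Filter Topology in
/-- Approximations with high precision certify every strict lower bound for the probability of the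
observations given the value at `i`. -/
theorem CausalNetwork.sfCode_of_lt (N : CausalNetwork U n) (x : Fin n → Word) (i : Fin n)
    {d : Word} (hd : Computes U d [] (N.marginal i)) {L : ℕ}
    (hL : 2⁻¹ ^ L * N.marginal i (x i) < N.joint x) :
    SFCode U (parents N.graph) i (tuple [tupleOn N.word Finset.univ, d, x i])
      (tupleOn x Finset.univ) L := by
  have hmech := fun j (k : ℕ) => N.word_computes j x (x j) k
  choose rs hrs hrs' using hmech
  choose r hr hr' using hd (x i)
  have hinv : Tendsto (fun k : ℕ => 1 / (2 : ℝ) ^ k) atTop (𝓝 0) := by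
    simpa using tendsto_pow_atTop_nhds_zero_of_lt_one (r := (2⁻¹ : ℝ)) (by norm_num) (by norm_num)
  have hj : ∀ j, Tendsto (fun k => (((rs j k).length - 1 : ℕ) : ℝ) / 2 ^ k) atTop
      (𝓝 (N.condProb x j).toReal) := by
    intro j
    have hlow : Tendsto (fun k : ℕ => (N.condProb x j).toReal - (1 / (2 : ℝ) ^ k + 1 / 2 ^ k)) atTop
        (𝓝 (N.condProb x j).toReal) := by
      simpa using (tendsto_const_nhds (x := (N.condProb x j).toReal)).sub (hinv.add hinv)
    have hhigh : Tendsto (fun k : ℕ => (N.condProb x j).toReal + 1 / (2 : ℝ) ^ k) atTop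
        (𝓝 (N.condProb x j).toReal) := by
      simpa using (tendsto_const_nhds (x := (N.condProb x j).toReal)).add hinv
    refine tendsto_of_tendsto_of_tendsto_of_le_of_le hlow hhigh (fun k => ?_) fun k => ?_
    · have h1 := (abs_le.1 (hrs' j k)).1
      have h2 : ((rs j k).length : ℝ) - 1 ≤ ((rs j k).length - 1 : ℕ) := by
        rw [sub_le_iff_le_add]
        have : (rs j k).length ≤ (rs j k).length - 1 + 1 := by omega
        exact_mod_cast this
      have h3 : ((rs j k).length : ℝ) / 2 ^ k - 1 / 2 ^ k ≤
          ((rs j k).length - 1 : ℕ) / 2 ^ k := by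
        rw [← sub_div]
        gcongr
      simp only [condProb]
      linarith
    · have h1 := (abs_le.1 (hrs' j k)).2
      have h2 : (((rs j k).length - 1 : ℕ) : ℝ) / 2 ^ k ≤ (rs j k).length / 2 ^ k := by
        gcongr
        exact Nat.sub_le _ _
      simp only [condProb]
      linarith
  have hi : Tendsto (fun k => (((r k).length : ℝ) + 1) / 2 ^ k) atTop
      (𝓝 (N.marginal i (x i)).toReal) := by
    have hlow : Tendsto (fun k : ℕ => (N.marginal i (x i)).toReal - 1 / (2 : ℝ) ^ k) atTop
        (𝓝 (N.marginal i (x i)).toReal) := by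
      simpa using (tendsto_const_nhds (x := (N.marginal i (x i)).toReal)).sub hinv
    have hhigh : Tendsto (fun k : ℕ => (N.marginal i (x i)).toReal + (1 / (2 : ℝ) ^ k + 1 / 2 ^ k))
        atTop (𝓝 (N.marginal i (x i)).toReal) := by
      simpa using (tendsto_const_nhds (x := (N.marginal i (x i)).toReal)).add (hinv.add hinv)
    refine tendsto_of_tendsto_of_tendsto_of_le_of_le hlow hhigh (fun k => ?_) fun k => ?_
    · have h1 := (abs_le.1 (hr' k)).1
      have h2 : (0 : ℝ) ≤ 1 / 2 ^ k := by positivity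
      simp only [add_div]
      linarith
    · have h1 := (abs_le.1 (hr' k)).2
      simp only [add_div]
      linarith
  have hlt : (N.marginal i (x i)).toReal < 2 ^ L * ∏ j, (N.condProb x j).toReal := by
    have h1 := (ENNReal.toReal_lt_toReal (by
      exact ENNReal.mul_ne_top (by simp) (ne_top_of_le_ne_top ENNReal.one_ne_top
        (N.marginal_le_one i (x i)))) (ne_top_of_le_ne_top ENNReal.one_ne_top
          ((N.joint_le_marginal x i).trans (N.marginal_le_one i (x i))))).2 hL
    rw [joint, ENNReal.toReal_prod, ENNReal.toReal_mul, ENNReal.toReal_pow, ENNReal.toReal_inv,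
      ENNReal.toReal_ofNat, inv_pow, inv_mul_lt_iff₀ (by positivity)] at h1
    exact h1
  obtain ⟨k, hk⟩ := (hi.eventually_lt ((tendsto_finsetProd Finset.univ fun j _ => hj j).const_mul
    (2 ^ L : ℝ)) hlt).exists
  refine ⟨((N.word, x, d), (fun j => rs j k), r k, k), rfl, rfl, fun j => hrs j k, hr k, ?_⟩
  rw [Finset.prod_div_distrib, Finset.prod_const, Finset.card_univ, Fintype.card_fin, ← pow_mul,
    mul_div_assoc', div_lt_div_iff₀ (by positivity) (by positivity)] at hk
  have hk' : ((r k).length + 1) * 2 ^ (k * n) < 2 ^ L * (∏ j, ((rs j k).length - 1)) * 2 ^ k := by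
    exact_mod_cast hk
  simp only
  linarith

/-- The certificates are sound. They mention only the words in the side input, which determine the
mechanisms and the marginal distribution since tuples are decodable. -/
theorem CausalNetwork.lt_of_sfCode (N : CausalNetwork U n) (i : Fin n) {a d : Word}
    (hd : Computes U d [] (N.marginal i)) {w : Word} {L : ℕ}
    (h : SFCode U (parents N.graph) i (tuple [tupleOn N.word Finset.univ, d, a]) w L) :
    ∃ x : Fin n → Word, x i = a ∧ tupleOn x Finset.univ = w ∧
      2⁻¹ ^ L * N.marginal i (x i) < N.joint x := by
  obtain ⟨⟨⟨ms, x, d'⟩, rs, r, k⟩, hy, rfl, hrs, hr, hlt⟩ := h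
  have hy' := tuple_injective hy
  simp only [List.cons.injEq, and_true] at hy'
  obtain ⟨h1, rfl, rfl⟩ := hy'
  obtain rfl := tupleOn_univ_injective h1
  refine ⟨x, rfl, rfl, ?_⟩
  simp only at hrs hr hlt
  have hj : ∀ j, (((rs j).length - 1 : ℕ) : ℝ) ≤ 2 ^ k * (N.condProb x j).toReal := by
    intro j
    obtain ⟨r', hr', hle⟩ := N.word_computes j x (x j) k
    obtain rfl := Part.mem_unique hr' (hrs j)
    have h2 := (abs_le.1 hle).2
    rw [sub_le_iff_le_add, div_le_iff₀ (by positivity), add_mul, div_mul_cancel₀ _ (by positivity)]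
      at h2
    have h3 : (0 : ℝ) ≤ 2 ^ k * (N.condProb x j).toReal := by positivity
    rcases Nat.eq_zero_or_pos (rs j).length with h0 | hpos
    · rw [h0]
      simpa only [Nat.zero_sub, Nat.cast_zero] using h3
    · rw [Nat.cast_sub hpos]
      simp only [condProb, Nat.cast_one] at *
      linarith
  have hi : 2 ^ k * (N.marginal i (x i)).toReal ≤ r.length + 1 := by
    obtain ⟨r', hr', hle⟩ := hd (x i) k
    obtain rfl := Part.mem_unique hr' hr
    have h2 := (abs_le.1 hle).1
    rw [neg_le_sub_iff_le_add, ← add_div, le_div_iff₀ (by positivity)] at h2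
    linarith
  have hlt' : ((r.length : ℝ) + 1) * 2 ^ (k * n)
      < 2 ^ L * 2 ^ k * ∏ j, (((rs j).length - 1 : ℕ) : ℝ) := by exact_mod_cast hlt
  have hprod : ∏ j, (((rs j).length - 1 : ℕ) : ℝ)
      ≤ 2 ^ (k * n) * ∏ j, (N.condProb x j).toReal := by
    calc ∏ j, (((rs j).length - 1 : ℕ) : ℝ) ≤ ∏ j, 2 ^ k * (N.condProb x j).toReal :=
          Finset.prod_le_prod (fun _ _ => by positivity) fun j _ => hj j
      _ = 2 ^ (k * n) * ∏ j, (N.condProb x j).toReal := by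
          rw [Finset.prod_mul_distrib, Finset.prod_const, Finset.card_univ, Fintype.card_fin,
            pow_mul]
  have hreal : (N.marginal i (x i)).toReal < 2 ^ L * ∏ j, (N.condProb x j).toReal := by
    have h3 : 2 ^ k * (N.marginal i (x i)).toReal * 2 ^ (k * n)
        < 2 ^ L * 2 ^ k * (2 ^ (k * n) * ∏ j, (N.condProb x j).toReal) :=
      (mul_le_mul_of_nonneg_right hi (by positivity)).trans_lt
        (hlt'.trans_le (mul_le_mul_of_nonneg_left hprod (by positivity)))
    have h4 : (0 : ℝ) < 2 ^ k * 2 ^ (k * n) := by positivity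
    refine lt_of_mul_lt_mul_left ?_ h4.le
    linarith
  rw [← ENNReal.toReal_lt_toReal (ENNReal.mul_ne_top (by simp) (ne_top_of_le_ne_top
    ENNReal.one_ne_top (N.marginal_le_one i (x i)))) (ne_top_of_le_ne_top ENNReal.one_ne_top
    ((N.joint_le_marginal x i).trans (N.marginal_le_one i (x i)))), joint, ENNReal.toReal_prod,
    ENNReal.toReal_mul, ENNReal.toReal_pow, ENNReal.toReal_inv, ENNReal.toReal_ofNat, inv_pow,
    inv_mul_lt_iff₀ (by positivity)]
  exact hreal

/-- Shannon–Fano coding: given the mechanisms, the marginal distribution of the node `i` and the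
value at `i`, the observations have complexity at most `-log (P(x) / P(x_i))`. -/
theorem IsUniversal.exists_K_tupleOn_le (hU : IsUniversal U) (n : ℕ) :
    ∃ c : ℕ, ∀ (N : CausalNetwork U n) (x : Fin n → Word) (i : Fin n) (d : Word),
      Computes U d [] (N.marginal i) →
      ∀ L : ℕ, 2⁻¹ ^ L * N.marginal i (x i) < N.joint x →
        K U (tupleOn x Finset.univ) (tuple [tupleOn N.word Finset.univ, d, x i]) ≤ L + c := by
  have hcode := fun q : (Fin n → Finset (Fin n)) × Fin n =>
    hU.exists_K_le_of_lt (semiDec_sfCode hU.1 q.1 q.2)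
  choose c hc using hcode
  refine ⟨Finset.univ.sup c, fun N x i d hd L hL => ?_⟩
  -- the distribution of the observations conditional on the value at `i`
  let m : Word → ℝ≥0∞ := fun w =>
    (∑' z : {z : {z : Fin n → Word // z i = x i} // tupleOn z.1 Finset.univ = w}, N.joint z.1)
      / N.marginal i (x i)
  have hm : ∑' w, m w ≤ 1 := by
    have hsum : ∑' s : (w : Word) × {z : {z : Fin n → Word // z i = x i} //
        tupleOn z.1 Finset.univ = w}, N.joint s.2.1 = N.marginal i (x i) :=
      (Equiv.sigmaFiberEquiv fun z : {z : Fin n → Word // z i = x i} =>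
        tupleOn z.1 Finset.univ).tsum_eq fun z => N.joint z.1
    simp only [m, div_eq_mul_inv]
    rw [ENNReal.tsum_mul_right, ← ENNReal.tsum_sigma' fun s : (w : Word) ×
      {z : {z : Fin n → Word // z i = x i} // tupleOn z.1 Finset.univ = w} => N.joint s.2.1,
      hsum]
    exact ENNReal.div_self_le_one
  have hcm : ∀ w L, SFCode U (parents N.graph) i
      (tuple [tupleOn N.word Finset.univ, d, x i]) w L → 2⁻¹ ^ L < m w := by
    intro w L h
    obtain ⟨z, hz, rfl, hlt⟩ := N.lt_of_sfCode i hd h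
    refine lt_of_lt_of_le ?_ (ENNReal.div_le_div_right (ENNReal.le_tsum
      (f := fun z' : {z' : {z : Fin n → Word // z i = x i} //
        tupleOn z'.1 Finset.univ = tupleOn z Finset.univ} => N.joint z'.1) ⟨⟨z, hz⟩, rfl⟩) _)
    have hpos := (zero_le.trans_lt (hlt.trans_le (N.joint_le_marginal z i))).ne'
    rw [hz] at hlt hpos
    refine (ENNReal.lt_div_iff_mul_lt (Or.inl ?_) (Or.inl ?_)).2 hlt
    · exact hpos
    · exact ne_top_of_le_ne_top ENNReal.one_ne_top (N.marginal_le_one i _)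
  refine (hc (parents N.graph, i) _ m hm hcm _ L (N.sfCode_of_lt x i hd hL)).trans ?_
  gcongr
  exact Finset.le_sup (f := c) (Finset.mem_univ (parents N.graph, i))

/-! ### The algorithmic Markov condition for the augmented graph -/

/-- In the lexicographic order of a sum, the left copies precede the right ones. -/
theorem sort_disjSum_lex {V : Type} [LinearOrder V] (s t : Finset V) (u : Finset (V ⊕ₗ V))
    (hl : ∀ v, Sum.inlₗ v ∈ u ↔ v ∈ s) (hr : ∀ v, Sum.inrₗ v ∈ u ↔ v ∈ t) :
    u.sort (· ≤ ·) = (s.sort (· ≤ ·)).map Sum.inlₗ ++ (t.sort (· ≤ ·)).map Sum.inrₗ := by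
  classical
  set l := (s.sort (· ≤ ·)).map Sum.inlₗ ++ (t.sort (· ≤ ·)).map (Sum.inrₗ : V → V ⊕ₗ V) with hl'
  have hnodup : l.Nodup := by
    refine List.Nodup.append ((s.sort_nodup _).map (toLex.injective.comp Sum.inl_injective))
      ((t.sort_nodup _).map (toLex.injective.comp Sum.inr_injective)) ?_
    intro a ha hb
    obtain ⟨v, -, rfl⟩ := List.mem_map.1 ha
    obtain ⟨w, -, h⟩ := List.mem_map.1 hb
    exact Sum.inr_ne_inl (toLex.injective h)
  have hu : l.toFinset = u := by
    ext a
    rcases h : ofLex a with v | v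
    · obtain rfl : a = Sum.inlₗ v := ofLex.injective h
      simp [hl', hl]
    · obtain rfl : a = Sum.inrₗ v := ofLex.injective h
      simp [hl', hr]
  rw [← hu]
  refine (List.toFinset_sort _ hnodup).2 (List.pairwise_append.2 ⟨?_, ?_, ?_⟩)
  · exact List.pairwise_map.2 ((s.pairwise_sort _).imp fun h => Sum.Lex.inl_le_inl_iff.2 h)
  · exact List.pairwise_map.2 ((t.pairwise_sort _).imp fun h => Sum.Lex.inr_le_inr_iff.2 h)
  · intro a ha b hb
    obtain ⟨v, -, rfl⟩ := List.mem_map.1 ha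
    obtain ⟨w, -, rfl⟩ := List.mem_map.1 hb
    exact (Sum.Lex.inl_lt_inr v w).le

theorem CausalNetwork.tupleOn_nodeWords (N : CausalNetwork U n) (x : Fin n → Word) :
    tupleOn (N.nodeWords x) Finset.univ = tupleOn x Finset.univ ++ tupleOn N.word Finset.univ := by
  unfold tupleOn
  rw [sort_disjSum_lex Finset.univ Finset.univ Finset.univ (by simp) (by simp), List.map_append,
    tuple_append, List.map_map, List.map_map]
  rfl

/-- The parents of an observation in the augmented graph carry the words relative to which
`condDeficiency` is defined. -/
theorem CausalNetwork.tupleOn_parents_inl (N : CausalNetwork U n) (x : Fin n → Word) (j : Fin n) :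
    tupleOn (N.nodeWords x) (parents (augment N.graph) (Sum.inlₗ j))
      = tuple (((parents N.graph j).sort (· ≤ ·)).map x ++ [N.word j]) := by
  unfold tupleOn
  rw [sort_disjSum_lex (parents N.graph j) {j} (parents (augment N.graph) (Sum.inlₗ j))
    (by intro v; rw [mem_parents, mem_parents]; rfl)
    (by intro v; rw [mem_parents, Finset.mem_singleton]; rfl), List.map_append, List.map_map,
    List.map_map, Finset.sort_singleton]
  rfl

theorem CausalNetwork.tupleOn_parents_inr (N : CausalNetwork U n) (x : Fin n → Word) (j : Fin n) :
    tupleOn (N.nodeWords x) (parents (augment N.graph) (Sum.inrₗ j)) = [] := by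
  unfold tupleOn
  rw [sort_disjSum_lex ∅ ∅ (parents (augment N.graph) (Sum.inrₗ j))
    (by intro v; rw [mem_parents]; simp [augment])
    (by intro v; rw [mem_parents]; simp [augment])]
  simp [tuple_nil]

/-- The words at the parents of the observation `j` in the augmented graph. -/
noncomputable def CausalNetwork.parentWords (N : CausalNetwork U n) (x : Fin n → Word)
    (j : Fin n) : Word :=
  tuple (((parents N.graph j).sort (· ≤ ·)).map x ++ [N.word j])

theorem CausalNetwork.sum_K_le_of_algMarkov (N : CausalNetwork U n) {x : Fin n → Word} {c : ℕ}
    (h : AlgMarkov U (augment N.graph) (N.nodeWords x) c) :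
    ∑ j, K U (x j) (shortestProgram U (N.parentWords x j))
        + ∑ j, K U (N.word j) (shortestProgram U [])
      ≤ K U (tupleOn x Finset.univ ++ tupleOn N.word Finset.univ) [] + c := by
  unfold AlgMarkov at h
  rw [N.tupleOn_nodeWords, ← toLex.sum_comp, Fintype.sum_sum_type] at h
  have h1 : ∀ j, K U (N.nodeWords x (toLex (Sum.inl j))) (shortestProgram U
      (tupleOn (N.nodeWords x) (parents (augment N.graph) (toLex (Sum.inl j)))))
      = K U (x j) (shortestProgram U (N.parentWords x j)) := fun j => by
    rw [show toLex (Sum.inl j) = Sum.inlₗ j from rfl, N.tupleOn_parents_inl]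
    rfl
  have h2 : ∀ j, K U (N.nodeWords x (toLex (Sum.inr j))) (shortestProgram U
      (tupleOn (N.nodeWords x) (parents (augment N.graph) (toLex (Sum.inr j)))))
      = K U (N.word j) (shortestProgram U []) := fun j => by
    rw [show toLex (Sum.inr j) = Sum.inrₗ j from rfl, N.tupleOn_parents_inr]
    rfl
  simp only [h1, h2] at h
  have := (abs_le.1 h).1
  zify
  linarith

/-- The conditional complexities of all observations together do not exceed, up to a constant, the
complexity of a single observation plus the codelength `-log (P(x) / P(x_i))` of the others. -/
theorem IsUniversal.exists_sum_K_le (hU : IsUniversal U) (n c : ℕ) :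
    ∃ C : ℕ, ∀ (N : CausalNetwork U n) (x : Fin n → Word) (i : Fin n) (d : Word),
      N.DescribesMarginal c i d → AlgMarkov U (augment N.graph) (N.nodeWords x) c →
      ∀ L : ℕ, 2⁻¹ ^ L * N.marginal i (x i) < N.joint x →
        ∑ j, K U (x j) (shortestProgram U (N.parentWords x j))
          ≤ K U (x i) (shortestProgram U d) + L + C := by
  obtain ⟨c₁, h₁⟩ := hU.exists_K_tuple_le (shortestProgram U [])
  obtain ⟨c₂, h₂⟩ := hU.exists_K_append_le
  obtain ⟨c₃, h₃⟩ := hU.exists_le_K_pair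
  obtain ⟨c₄, h₄⟩ := hU.exists_K_pair_le
  obtain ⟨c₅, h₅⟩ := hU.exists_K_tupleOn_le n
  refine ⟨c + c + c₁ * (n + 1) + c₂ + c₃ + c₄ + c₅, fun N x i d hd hG L hL => ?_⟩
  have e₁ : K U (tupleOn N.word Finset.univ) [] ≤
      ∑ j, K U (N.word j) (shortestProgram U []) + c₁ * (n + 1) := by
    have h := h₁ ((Finset.univ.sort (· ≤ ·)).map N.word)
    rw [List.map_map, List.length_map, Finset.length_sort, Finset.card_univ,
      Fintype.card_fin] at h
    refine h.trans (le_of_eq ?_)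
    congr 1
    rw [Finset.sum_eq_multiset_sum, ← Finset.sort_eq Finset.univ (· ≤ ·), Multiset.map_coe,
      Multiset.sum_coe]
    rfl
  have e₂ := h₂ (tupleOn x Finset.univ) (tupleOn N.word Finset.univ) d (x i)
  have e₃ := h₃ (tupleOn N.word Finset.univ) d
  have e₄ := h₄ d (tupleOn N.word Finset.univ)
  have e₅ := h₅ N x i d hd.1 L hL
  have e₇ := N.sum_K_le_of_algMarkov hG
  have e₈ := hd.2
  omega

/-! ### Deficiencies -/

theorem deficiency_of_ne_zero {p : ℝ≥0∞} (hp : p ≠ 0) (x z : Word) : deficiency U p x z =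
    ((-Real.logb 2 p.toReal - K U x (shortestProgram U z) : ℝ) : EReal) := by
  simp [deficiency, negLog, hp]

theorem deficiency_zero (x z : Word) : deficiency U 0 x z = ⊤ := by
  rw [deficiency, negLog, if_pos rfl, EReal.top_sub_coe]

/-- The sum of the conditional deficiencies bounds the deficiency of each single observation. -/
theorem IsUniversal.exists_deficiency_le (hU : IsUniversal U) (n c : ℕ) :
    ∃ C : ℕ, ∀ (N : CausalNetwork U n) (x : Fin n → Word) (i : Fin n) (d : Word),
      N.DescribesMarginal c i d → AlgMarkov U (augment N.graph) (N.nodeWords x) c →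
      (∀ j, N.condProb x j ≠ 0) → N.marginal i (x i) ≠ 0 ∧
      -Real.logb 2 (N.marginal i (x i)).toReal - K U (x i) (shortestProgram U d) ≤
        ∑ j, (-Real.logb 2 (N.condProb x j).toReal
          - K U (x j) (shortestProgram U (N.parentWords x j))) + C := by
  obtain ⟨C, hC⟩ := hU.exists_sum_K_le n c
  refine ⟨C + 1, fun N x i d hd hG hne => ?_⟩
  have hjoint : N.joint x ≠ 0 := Finset.prod_ne_zero_iff.2 fun j _ => hne j
  have hle := N.joint_le_marginal x i
  have hmarg : N.marginal i (x i) ≠ 0 := (pos_iff_ne_zero.2 hjoint |>.trans_le hle).ne'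
  have hmtop : N.marginal i (x i) ≠ ⊤ := ne_top_of_le_ne_top ENNReal.one_ne_top
    (N.marginal_le_one i (x i))
  have hjtop : N.joint x ≠ ⊤ := ne_top_of_le_ne_top hmtop hle
  refine ⟨hmarg, ?_⟩
  have hP : 0 < (N.joint x).toReal := ENNReal.toReal_pos hjoint hjtop
  have hQ : 0 < (N.marginal i (x i)).toReal := ENNReal.toReal_pos hmarg hmtop
  have hPQ : (N.joint x).toReal ≤ (N.marginal i (x i)).toReal := ENNReal.toReal_mono hmtop hle
  set P := (N.joint x).toReal with hPdef
  set Q := (N.marginal i (x i)).toReal with hQdef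
  have hlog : Real.logb 2 P = ∑ j, Real.logb 2 (N.condProb x j).toReal := by
    rw [hPdef, CausalNetwork.joint, ENNReal.toReal_prod, Real.logb_prod]
    intro j _
    exact (ENNReal.toReal_pos (hne j)
      (ne_top_of_le_ne_top ENNReal.one_ne_top (N.condProb_le_one x j))).ne'
  have hlogle : Real.logb 2 P ≤ Real.logb 2 Q := Real.logb_le_logb_of_le one_lt_two hP hPQ
  -- the least integer codelength strictly above `-log (P(x) / P(x_i))`
  set L := ⌊Real.logb 2 Q - Real.logb 2 P⌋₊ + 1 with hLdef
  have hL1 : (L : ℝ) ≤ Real.logb 2 Q - Real.logb 2 P + 1 := by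
    rw [hLdef]
    push_cast
    have := Nat.floor_le (sub_nonneg.2 hlogle)
    linarith
  have hL2 : Real.logb 2 Q - Real.logb 2 P < L := by
    rw [hLdef]
    push_cast
    exact Nat.lt_floor_add_one _
  have hL : 2⁻¹ ^ L * N.marginal i (x i) < N.joint x := by
    rw [← ENNReal.toReal_lt_toReal (ENNReal.mul_ne_top (by simp) hmtop) hjtop, ENNReal.toReal_mul,
      ENNReal.toReal_pow, ENNReal.toReal_inv, ENNReal.toReal_ofNat, inv_pow,
      inv_mul_lt_iff₀ (by positivity), ← hPdef, ← hQdef,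
      ← Real.logb_lt_logb_iff one_lt_two hQ (by positivity), Real.logb_mul (by positivity) hP.ne',
      Real.logb_pow, Real.logb_self_eq_one one_lt_two]
    linarith
  have h := hC N x i d hd hG L hL
  have h' : ((∑ j, K U (x j) (shortestProgram U (N.parentWords x j)) : ℕ) : ℝ)
      ≤ K U (x i) (shortestProgram U d) + L + C := by exact_mod_cast h
  rw [Finset.sum_sub_distrib, Finset.sum_neg_distrib, ← hlog]
  push_cast at h' ⊢
  linarith

end AIT

theorem mainTheorem2 (U : AIT.Word → AIT.Word →. AIT.Word) (hU : AIT.IsUniversal U) (n c : ℕ) :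
    ∃ C : ℕ, ∀ (N : AIT.CausalNetwork U n) (x : Fin n → AIT.Word) (d : Fin n → AIT.Word),
      (∀ i, N.DescribesMarginal c i (d i)) →
      AIT.AlgMarkov U (AIT.augment N.graph) (N.nodeWords x) c →
      ∀ j : Fin n,
        (∀ i, i ≠ j → -(c : EReal) ≤ N.condDeficiency x i ∧ N.condDeficiency x i ≤ (c : EReal)) →
        ∀ i, N.margDeficiency i (d i) (x i) ≤ N.condDeficiency x j + (C : EReal) := by
  obtain ⟨C, hC⟩ := hU.exists_deficiency_le n c
  refine ⟨n * c + C, fun N x d hd hG j hj i => ?_⟩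
  by_cases hne : ∀ k, N.condProb x k ≠ 0
  · obtain ⟨hmarg, hle⟩ := hC N x i (d i) (hd i) hG hne
    have hcond : ∀ k, N.condDeficiency x k = ((-Real.logb 2 (N.condProb x k).toReal
        - AIT.K U (x k) (AIT.shortestProgram U (N.parentWords x k)) : ℝ) : EReal) := fun k =>
      AIT.deficiency_of_ne_zero (hne k) _ _
    rw [hcond, AIT.CausalNetwork.margDeficiency, AIT.deficiency_of_ne_zero hmarg]
    have hsum : ∑ k ∈ Finset.univ.erase j, (-Real.logb 2 (N.condProb x k).toReal
        - AIT.K U (x k) (AIT.shortestProgram U (N.parentWords x k))) ≤ n * c := by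
      refine (Finset.sum_le_card_nsmul _ _ (c : ℝ) fun k hk => ?_).trans ?_
      · have h := (hj k (Finset.ne_of_mem_erase hk)).2
        rw [hcond] at h
        exact_mod_cast h
      · rw [nsmul_eq_mul]
        gcongr
        exact_mod_cast (Finset.card_le_univ _).trans_eq (Fintype.card_fin n)
    rw [← Finset.add_sum_erase _ _ (Finset.mem_univ j)] at hle
    have hreal : -Real.logb 2 (N.marginal i (x i)).toReal
        - AIT.K U (x i) (AIT.shortestProgram U (d i)) ≤
        (-Real.logb 2 (N.condProb x j).toReal
          - AIT.K U (x j) (AIT.shortestProgram U (N.parentWords x j))) + ((n * c + C : ℕ) : ℝ) := by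
      push_cast
      linarith
    exact_mod_cast hreal
  · -- a mechanism of probability zero has infinite deficiency, so it is that of the root cause
    push Not at hne
    obtain ⟨k, hk⟩ := hne
    have htop : N.condDeficiency x k = ⊤ := by
      rw [AIT.CausalNetwork.condDeficiency, hk, AIT.deficiency_zero]
    rcases eq_or_ne k j with rfl | hkj
    · rw [htop, EReal.top_add_of_ne_bot (EReal.natCast_ne_bot _)]
      exact le_top
    · have h := (hj k hkj).2
      rw [htop, top_le_iff] at h
      exact absurd h (EReal.coe_ne_top _)
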